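/- A digraph $D=(V,A)$ is finite and may have loops and parallel or antiparallel arcs. A map $f:A\to\mathbb Z$ is a *flow* in $D$ if $\sum_{a\in\partial^+(v)}f(a)=\sum_{a\in\partial^-(v)}f(a)$ for every $v\in V$; it is an *NL-flow* if, moreover, contracting its support $\operatorname{supp}(f)=\{a: f(a)\neq 0\}$ yields a totally cyclic digraph $D/\operatorname{supp}(f)$, i.e. one in which every (weak) component is strongly connected. A map $g:A\to\mathbb Z$ is a *coflow* in $D$ if $\sum_{a\in C^+}g(a)=\sum_{a\in C^-}g(a)$ for every (weak) cycle $C$ of $D$, where $C^+$ and $C^-$ are the sets of arcs of $C$ traversed forwards and backwards; it is an *NL-coflow* if, moreover, $\operatorname{supp}(g)$ contains a feedback arc set, i.e. a set $S\subseteq A$ such that $D-S$ has no directed cycle. A *plane digraph* is a digraph whose vertices are distinct points of the plane and whose arcs are simple polygonal curves (simple closed polygons for loops) from tail to head, such that the interior of an arc contains no vertex and no point of another arc; it need not be connected. Its *plane dual* $D^*=(V^*,A^*)$ has the faces of $D$ (the connected components of the complement of the drawing) as vertices, and for each $a\in A$ one arc $a^*\in A^*$, crossing $a$ from left to right: its tail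 is the face on the left of $a$ and its head is the face on the right of $a$. For $g:A\to\mathbb Z$ let $g^*:A^*\to\mathbb Z$ be given by $g^*(a^*)=g(a)$. **Theorem.** Let $D=(V,A)$ be a plane digraph with plane dual $D^*$. A map $g:A\to\mathbb Z$ is an NL-coflow in $D$ if and only if the map $g^*$ is an NL-flow in $D^*$. -/

import Mathlib

open Set

/-- A digraph with vertex set `V` and arc set `A`; loops, parallel and antiparallel arcs are
allowed. -/
structure MultiDigraph (V A : Type*) where
  tail : A → V
  head : A → V

namespace MultiDigraph

variable {V A G : Type*}

/-- Some arc runs from `u` to `v`. -/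
def Adj (D : MultiDigraph V A) (u v : V) : Prop :=
  ∃ a, D.tail a = u ∧ D.head a = v

/-- A (weak) cycle of length `n + 1`, with a direction of traversal: distinct vertices
`vert 0, …, vert n` and distinct arcs `arc 0, …, arc n`, where `arc i` joins `vert i` to
`vert (i + 1)` (indices cyclic modulo `n + 1`).  The arcs with `fwd i = true` are traversed
from tail to head and form `C⁺`; the others are traversed backwards and form `C⁻`. -/
structure WeakCycle (D : MultiDigraph V A) where
  n : ℕ
  vert : Fin (n + 1) → V
  arc : Fin (n + 1) → A
  fwd : Fin (n + 1) → Bool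
  vert_injective : Function.Injective vert
  arc_injective : Function.Injective arc
  forward : ∀ i, fwd i = true → D.tail (arc i) = vert i ∧ D.head (arc i) = vert (i + 1)
  backward : ∀ i, fwd i = false → D.head (arc i) = vert i ∧ D.tail (arc i) = vert (i + 1)

/-- A cycle all of whose arcs are traversed forwards. -/
def WeakCycle.IsDirected {D : MultiDigraph V A} (C : D.WeakCycle) : Prop :=
  ∀ i, C.fwd i = true

/-- There is no directed cycle. -/
def IsAcyclic (D : MultiDigraph V A) : Prop :=
  ¬ ∃ C : D.WeakCycle, C.IsDirected

/-- Every (weak) component is strongly connected. -/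
def IsTotallyCyclic (D : MultiDigraph V A) : Prop :=
  ∀ u v, Relation.EqvGen D.Adj u v → Relation.ReflTransGen D.Adj u v

/-- The digraph `D - S`. -/
def deleteArcs (D : MultiDigraph V A) (S : Set A) : MultiDigraph V {a : A // a ∉ S} where
  tail a := D.tail a
  head a := D.head a

/-- The vertices of `D / S`: `Quot` identifies the vertices that are related by the equivalence
relation generated by "`u` and `v` are the ends of an arc in `S`". -/
def ContractVertex (D : MultiDigraph V A) (S : Set A) : Type _ :=
  Quot fun u v : V => ∃ a ∈ S, D.tail a = u ∧ D.head a = v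

/-- The digraph `D / S`. -/
def contractArcs (D : MultiDigraph V A) (S : Set A) :
    MultiDigraph (D.ContractVertex S) {a : A // a ∉ S} where
  tail a := Quot.mk _ (D.tail a)
  head a := Quot.mk _ (D.head a)

/-- `S` is a feedback arc set of `D`. -/
def IsFeedbackArcSet (D : MultiDigraph V A) (S : Set A) : Prop :=
  (D.deleteArcs S).IsAcyclic

open Classical in
/-- Flow conservation at every vertex. -/
def IsFlow [AddCommGroup G] [Fintype A] (D : MultiDigraph V A) (f : A → G) : Prop :=
  ∀ v : V, ∑ a with D.tail a = v, f a = ∑ a with D.head a = v, f a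

/-- Kirchhoff's law for all (weak) cycles. -/
def IsCoflow [AddCommGroup G] (D : MultiDigraph V A) (g : A → G) : Prop :=
  ∀ C : D.WeakCycle,
    ∑ i with C.fwd i = true, g (C.arc i) = ∑ i with C.fwd i = false, g (C.arc i)

/-- An NL-flow: a flow such that contracting its support yields a totally cyclic digraph. -/
def IsNLFlow [AddCommGroup G] [Fintype A] (D : MultiDigraph V A) (f : A → G) : Prop :=
  D.IsFlow f ∧ (D.contractArcs (Function.support f)).IsTotallyCyclic

/-- An NL-coflow: a coflow whose support contains a feedback arc set. -/
def IsNLCoflow [AddCommGroup G] (D : MultiDigraph V A) (g : A → G) : Prop :=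
  D.IsCoflow g ∧ ∃ S : Set A, S ⊆ Function.support g ∧ D.IsFeedbackArcSet S

end MultiDigraph

/-- The polygonal curve through `c 0, c 1, c 2, …`: for `i : ℕ` and `0 ≤ t ≤ 1` the point at
parameter `i + t` is `(1 - t) * c i + t * c (i + 1)`. -/
noncomputable def polyline (c : ℕ → ℂ) (x : ℝ) : ℂ :=
  AffineMap.lineMap (c ⌊x⌋₊) (c (⌊x⌋₊ + 1)) (x - (⌊x⌋₊ : ℝ))

/-- A plane digraph: a digraph whose vertices are distinct points of the plane `ℂ` and whose arcs
are simple polygonal curves (simple closed polygons, for loops) from tail to head.  The interior of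
an arc contains no vertex and no point of another arc.  The arc `a` consists of `len a ≥ 1`
segments, with successive corners `corner a 0, …, corner a (len a)`; later values of `corner a`
play no role. -/
structure PlaneDigraph (V A : Type*) extends MultiDigraph V A where
  pos : V → ℂ
  len : A → ℕ
  corner : A → ℕ → ℂ
  pos_injective : Function.Injective pos
  len_pos : ∀ a, 0 < len a
  corner_zero : ∀ a, corner a 0 = pos (tail a)
  corner_len : ∀ a, corner a (len a) = pos (head a)
  interior_injOn : ∀ a, InjOn (polyline (corner a)) (Ioo 0 (len a : ℝ))
  pos_notMem_interior : ∀ v a, pos v ∉ polyline (corner a) '' Ioo 0 (len a : ℝ)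
  interior_disjoint : ∀ a b, a ≠ b →
    Disjoint (polyline (corner a) '' Ioo 0 (len a : ℝ)) (polyline (corner b) '' Ioo 0 (len b : ℝ))

namespace PlaneDigraph

variable {V A : Type*}

/-- The point set of the drawing: all vertices and all arcs. -/
def drawing (D : PlaneDigraph V A) : Set ℂ :=
  range D.pos ∪ ⋃ a, polyline (D.corner a) '' Icc 0 (D.len a : ℝ)

/-- The faces: the connected components of the complement of the drawing. -/
def Face (D : PlaneDigraph V A) : Type :=
  ConnectedComponents ↥(D.drawing)ᶜ

/-- For `t > 0` a point to the left (for `t < 0` a point to the right) of the midpoint of the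
first segment of `a`, on the perpendicular to this segment. -/
noncomputable def sidePoint (D : PlaneDigraph V A) (a : A) (t : ℝ) : ℂ :=
  (D.corner a 0 + D.corner a 1) / 2 + t * (Complex.I * (D.corner a 1 - D.corner a 0))

theorem polyline_of_mem (c : ℕ → ℂ) (k : ℕ) (t : ℝ) (h0 : 0 ≤ t) (h1 : t < 1) :
    polyline c (k + t) = AffineMap.lineMap (c k) (c (k + 1)) t := by
  have h : ⌊(k : ℝ) + t⌋₊ = k := by
    rw [Nat.floor_eq_iff (by positivity)]
    constructor <;> linarith
  unfold polyline
  rw [h]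
  congr 1
  ring

theorem polyline_natCast (c : ℕ → ℂ) (k : ℕ) : polyline c k = c k := by
  have h := polyline_of_mem c k 0 le_rfl one_pos
  simpa using h

/-- A point of a segment of an arc is the corresponding point of the curve. -/
theorem exists_polyline_eq (c : ℕ → ℂ) (k : ℕ) {z : ℂ} (hz : z ∈ segment ℝ (c k) (c (k + 1))) :
    ∃ x : ℝ, (k : ℝ) ≤ x ∧ x ≤ k + 1 ∧ polyline c x = z := by
  rw [segment_eq_image_lineMap] at hz
  obtain ⟨t, ⟨h0, h1⟩, rfl⟩ := hz
  rcases h1.lt_or_eq with h1 | rfl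
  · exact ⟨k + t, by linarith, by linarith, polyline_of_mem c k t h0 h1⟩
  · refine ⟨k + 1, by linarith, le_rfl, ?_⟩
    have h := polyline_natCast c (k + 1)
    push_cast at h
    simp [h]

/-- A point of an arc before its end lies on a segment of the arc. -/
theorem polyline_mem_segment (c : ℕ → ℂ) {x : ℝ} (h0 : 0 ≤ x) :
    polyline c x ∈ segment ℝ (c ⌊x⌋₊) (c (⌊x⌋₊ + 1)) := by
  rw [segment_eq_image_lineMap]
  exact ⟨x - ⌊x⌋₊, ⟨by linarith [Nat.floor_le h0], by linarith [Nat.lt_floor_add_one x]⟩, rfl⟩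

theorem midpoint_eq (D : PlaneDigraph V A) (a : A) :
    polyline (D.corner a) (1 / 2) = (D.corner a 0 + D.corner a 1) / 2 := by
  have h := polyline_of_mem (D.corner a) 0 (1 / 2) (by norm_num) (by norm_num)
  simp only [Nat.cast_zero, zero_add] at h
  rw [h, AffineMap.lineMap_apply]
  simp only [vsub_eq_sub, vadd_eq_add, Complex.real_smul]
  push_cast
  ring

theorem corner_zero_ne_one (D : PlaneDigraph V A) (a : A) : D.corner a 0 ≠ D.corner a 1 := by
  intro h
  have hl : (1 : ℝ) ≤ D.len a := by exact_mod_cast D.len_pos a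
  have e (t : ℝ) (h0 : 0 ≤ t) (h1 : t < 1) : polyline (D.corner a) t = D.corner a 0 := by
    have h' := polyline_of_mem (D.corner a) 0 t h0 h1
    simpa [← h] using h'
  have h2 : (1 / 2 : ℝ) = 1 / 3 := D.interior_injOn a
    ⟨by norm_num, by linarith⟩ ⟨by norm_num, by linarith⟩
    ((e _ (by norm_num) (by norm_num)).trans (e _ (by norm_num) (by norm_num)).symm)
  norm_num at h2

/-- Near the midpoint of the first segment of `a`, the perpendicular to this segment meets the
drawing in the midpoint only. -/
theorem exists_sidePoint_notMem [Finite V] [Finite A] (D : PlaneDigraph V A) (a : A) :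
    ∃ ε : ℝ, 0 < ε ∧ ∀ t : ℝ, t ≠ 0 → |t| ≤ ε → D.sidePoint a t ∉ D.drawing := by
  classical
  have hla : (1 : ℝ) ≤ D.len a := by exact_mod_cast D.len_pos a
  have hmid : (1 / 2 : ℝ) ∈ Ioo 0 (D.len a : ℝ) := ⟨by norm_num, by linarith⟩
  let I : Set (A × ℕ) := {p | p.2 < D.len p.1 ∧ p ≠ (a, 0)}
  have hI : I.Finite := by
    have : (⋃ b : A, (fun k => (b, k)) '' Iio (D.len b)).Finite :=
      Set.finite_iUnion fun b => (Set.finite_Iio _).image _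
    refine this.subset ?_
    rintro ⟨b, k⟩ ⟨h, -⟩
    exact mem_iUnion.2 ⟨b, k, h, rfl⟩
  let K : Set ℂ := range D.pos ∪
    ⋃ p ∈ I, segment ℝ (D.corner p.1 p.2) (D.corner p.1 (p.2 + 1))
  have hK : IsClosed K := by
    refine (Set.finite_range _).isClosed.union (hI.isClosed_biUnion fun p _ => ?_)
    rw [segment_eq_image_lineMap]
    exact (isCompact_Icc.image AffineMap.lineMap_continuous).isClosed
  have hm : D.sidePoint a 0 ∉ K := by
    have e0 : D.sidePoint a 0 = polyline (D.corner a) (1 / 2) := by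
      rw [midpoint_eq]; simp [sidePoint]
    rw [e0]
    rintro (⟨v, hv⟩ | h)
    · exact D.pos_notMem_interior v a ⟨1 / 2, hmid, hv.symm⟩
    · simp only [mem_iUnion] at h
      obtain ⟨⟨b, k⟩, ⟨hk, hne⟩, h⟩ := h
      obtain ⟨x, hx0, hx1, hx⟩ := exists_polyline_eq _ _ h
      simp only at hk hx0 hx1 hx
      have hk' : (k : ℝ) + 1 ≤ D.len b := by exact_mod_cast hk
      have hk0 : (0 : ℝ) ≤ k := k.cast_nonneg
      rcases (hk0.trans hx0).eq_or_lt with h0 | h0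
      · apply D.pos_notMem_interior (D.tail b) a
        refine ⟨1 / 2, hmid, ?_⟩
        rw [← hx, ← h0, ← D.corner_zero]
        simpa using polyline_natCast (D.corner b) 0
      rcases (hx1.trans hk').eq_or_lt with h1 | h1
      · apply D.pos_notMem_interior (D.head b) a
        refine ⟨1 / 2, hmid, ?_⟩
        rw [← hx, h1, ← D.corner_len]
        exact polyline_natCast (D.corner b) _
      by_cases hab : a = b
      · subst hab
        have h2 := D.interior_injOn a ⟨h0, h1⟩ hmid hx
        have hk1 : k ≠ 0 := by
          rintro rfl
          exact hne rfl
        have : (1 : ℝ) ≤ k := by exact_mod_cast Nat.one_le_iff_ne_zero.2 hk1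
        linarith
      · exact Set.disjoint_left.1 (D.interior_disjoint a b hab) ⟨1 / 2, hmid, rfl⟩
          ⟨x, ⟨h0, h1⟩, hx⟩
  have hcont : Continuous (D.sidePoint a) := by
    unfold sidePoint
    fun_prop
  obtain ⟨δ, hδ, hball⟩ := Metric.isOpen_iff.1 (hK.isOpen_compl.preimage hcont) 0 hm
  refine ⟨δ / 2, by positivity, fun t ht0 ht hmem => ?_⟩
  have htK : D.sidePoint a t ∉ K := hball (by
    rw [Metric.mem_ball, Real.dist_eq, sub_zero]
    linarith)
  rcases hmem with h | h
  · exact htK (Or.inl h)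
  obtain ⟨b, x, ⟨hx0, hx1⟩, hx⟩ := mem_iUnion.1 h
  have hfl : ⌊x⌋₊ ≤ D.len b := Nat.floor_le_of_le hx1
  rcases hfl.eq_or_lt with hfl | hfl
  · have : x = D.len b := le_antisymm hx1 (by rw [← hfl]; exact Nat.floor_le hx0)
    subst this
    rw [polyline_natCast, D.corner_len] at hx
    exact htK (Or.inl ⟨_, hx⟩)
  have hseg := polyline_mem_segment (D.corner b) hx0
  rw [hx] at hseg
  by_cases hb : ((b, ⌊x⌋₊) : A × ℕ) = (a, 0)
  · obtain ⟨rfl, hb0⟩ := Prod.mk.inj hb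
    rw [hb0, segment_eq_image_lineMap] at hseg
    obtain ⟨s, -, hs⟩ := hseg
    have hne : D.corner b 1 - D.corner b 0 ≠ 0 := sub_ne_zero.2 (D.corner_zero_ne_one b).symm
    rw [AffineMap.lineMap_apply, sidePoint] at hs
    simp only [vsub_eq_sub, vadd_eq_add, Complex.real_smul, zero_add] at hs
    have h3 : ((s : ℂ) - 1 / 2 - t * Complex.I) * (D.corner b 1 - D.corner b 0) = 0 := by
      linear_combination hs
    have h4 := (mul_eq_zero.1 h3).resolve_right hne
    have h5 := congrArg Complex.im h4
    simp at h5
    exact ht0 h5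
  · exact htK (Or.inr (mem_iUnion₂.2 ⟨(b, ⌊x⌋₊), ⟨hfl, hb⟩, hseg⟩))

/-- A distance within which the perpendicular at the midpoint of the first segment of `a` meets
the drawing in this midpoint only. -/
noncomputable def sideDist [Finite V] [Finite A] (D : PlaneDigraph V A) (a : A) : ℝ :=
  (D.exists_sidePoint_notMem a).choose

theorem sideDist_pos [Finite V] [Finite A] (D : PlaneDigraph V A) (a : A) :
    0 < D.sideDist a :=
  (D.exists_sidePoint_notMem a).choose_spec.1

theorem sidePoint_notMem [Finite V] [Finite A] (D : PlaneDigraph V A) (a : A) {t : ℝ}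
    (h0 : t ≠ 0) (ht : |t| ≤ D.sideDist a) : D.sidePoint a t ∉ D.drawing :=
  (D.exists_sidePoint_notMem a).choose_spec.2 t h0 ht

/-- The face on the left of `a`. -/
noncomputable def leftFace [Finite V] [Finite A] (D : PlaneDigraph V A) (a : A) : D.Face :=
  ConnectedComponents.mk ⟨D.sidePoint a (D.sideDist a),
    D.sidePoint_notMem a (D.sideDist_pos a).ne' (abs_of_pos (D.sideDist_pos a)).le⟩

/-- The face on the right of `a`. -/
noncomputable def rightFace [Finite V] [Finite A] (D : PlaneDigraph V A) (a : A) : D.Face :=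
  ConnectedComponents.mk ⟨D.sidePoint a (-D.sideDist a),
    D.sidePoint_notMem a (neg_ne_zero.mpr (D.sideDist_pos a).ne')
      ((abs_neg _).trans (abs_of_pos (D.sideDist_pos a))).le⟩

/-- The plane dual `D*`, as a digraph.  Its vertices are the faces of `D`.  Each arc `a` of `D`
has one dual arc `a*`, which crosses `a` from left to right.  The arcs of `D*` are indexed by those
of `D`, so that the map `f*` with `f* a* = f a` is given by `f` itself. -/
noncomputable def dual [Finite V] [Finite A] (D : PlaneDigraph V A) : MultiDigraph D.Face A where
  tail := D.leftFace
  head := D.rightFace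

end PlaneDigraph

/-! The core is that the integer flows of `D` are exactly the maps `a ↦ φ (leftFace a) - φ
(rightFace a)` for integer functions `φ` on the faces. Neither the Jordan curve theorem nor
connectedness is needed.

From flows to potentials (`exists_face_potential`): add up, with weights `h`, the angles under which
the arcs are seen from a point `z`. Conservation makes the total a multiple of `2π`. It is
continuous off the drawing, hence constant on faces, and it jumps by `2π * h a` across `a`. Thus `φ`
is a winding number.

From potentials to flows (`isFlow_face_sub`): on a small circle around a point, the jumps of a face
function at the segments leaving that point add up to zero (`sum_sideValues_eq_zero`). At an inner
corner this says that the jump is the same along the whole arc; at a vertex it is conservation.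

An integer flow is a sum of signed cycles that conform to it, so a coflow is a map orthogonal to all
integer flows, that is, to all face coboundaries. This is conservation at every vertex of `D*`. The
same correspondence turns directed cycles of `D` that avoid the support into directed cuts of `D*`
that avoid it. Such cuts are what prevents `D* / supp` from being totally cyclic. -/

namespace MultiDigraph

/-! ### Flows, coflows and signed cycles in abstract digraphs -/

variable {V A M : Type*}

open Classical in
/-- A flow is orthogonal to every coboundary. -/
theorem IsFlow.sum_smul_sub [Fintype A] [AddCommGroup M] {D : MultiDigraph V A} {h : A → ℤ}
    (hh : D.IsFlow h) (P : V → M) : ∑ a, h a • (P (D.head a) - P (D.tail a)) = 0 := by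
  -- The vertex set need not be finite (it will be the set of faces), so sums over vertices are
  -- restricted to ends of arcs.
  set T : Finset V := Finset.univ.image D.tail ∪ Finset.univ.image D.head with hT
  have key (f : A → V) (hf : ∀ a, f a ∈ T) :
      ∑ a, h a • P (f a) = ∑ v ∈ T, (∑ a with f a = v, h a) • P v := by
    rw [← Finset.sum_fiberwise_of_maps_to (g := f) (t := T) (fun a _ => hf a)]
    refine Finset.sum_congr rfl fun v _ => ?_
    rw [Finset.sum_smul]
    refine Finset.sum_congr rfl fun a ha => ?_
    rw [(Finset.mem_filter.1 ha).2]
  simp only [smul_sub, Finset.sum_sub_distrib]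
  rw [key D.head fun a => by simp [hT], key D.tail fun a => by simp [hT], sub_eq_zero]
  exact Finset.sum_congr rfl fun v _ => by rw [hh v]

theorem IsFlow.sub [Fintype A] [AddCommGroup M] {D : MultiDigraph V A} {f h : A → M}
    (hf : D.IsFlow f) (hh : D.IsFlow h) : D.IsFlow (f - h) := fun v => by
  simp only [Pi.sub_apply, Finset.sum_sub_distrib, hf v, hh v]

namespace WeakCycle

variable {D : MultiDigraph V A}

/-- The sign of an arc of a weak cycle: `1` if it is traversed forwards, `-1` otherwise. -/
def sign (C : D.WeakCycle) (i : Fin (C.n + 1)) : ℤ := if C.fwd i then 1 else -1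

open Classical in
/-- The signed characteristic function of a weak cycle. -/
noncomputable def char (C : D.WeakCycle) (a : A) : ℤ :=
  ∑ i, if C.arc i = a then C.sign i else 0

theorem char_arc (C : D.WeakCycle) (i : Fin (C.n + 1)) : C.char (C.arc i) = C.sign i := by
  classical
  simp [char, C.arc_injective.eq_iff]

theorem char_eq_zero (C : D.WeakCycle) {a : A} (ha : ∀ i, C.arc i ≠ a) : C.char a = 0 := by
  simp [char, ha]

theorem sum_char_smul [Fintype A] [AddCommGroup M] (C : D.WeakCycle) (f : A → M) :
    ∑ a, C.char a • f a = ∑ i, C.sign i • f (C.arc i) := by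
  classical
  simp only [char, Finset.sum_smul]
  rw [Finset.sum_comm]
  refine Finset.sum_congr rfl fun i _ => ?_
  simp [ite_smul]

theorem sum_sign_smul [AddCommGroup M] (C : D.WeakCycle) (f : A → M) :
    ∑ i, C.sign i • f (C.arc i) =
      ∑ i with C.fwd i = true, f (C.arc i) - ∑ i with C.fwd i = false, f (C.arc i) := by
  rw [Finset.sum_filter, Finset.sum_filter, ← Finset.sum_sub_distrib]
  refine Finset.sum_congr rfl fun i _ => ?_
  cases h : C.fwd i <;> simp [sign, h]

/-- In either direction of traversal, the signed contribution of `arc i` at `v` is the indicator of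
`vert i = v` minus that of `vert (i + 1) = v`, and these cancel around the cycle. -/
theorem isFlow_char [Fintype A] (C : D.WeakCycle) : D.IsFlow C.char := by
  classical
  intro v
  rw [← sub_eq_zero, Finset.sum_filter, Finset.sum_filter, ← Finset.sum_sub_distrib]
  have h1 := C.sum_char_smul
    fun a => (if D.tail a = v then (1 : ℤ) else 0) - (if D.head a = v then 1 else 0)
  have h2 : ∀ i, C.sign i • ((if D.tail (C.arc i) = v then (1 : ℤ) else 0) -
      (if D.head (C.arc i) = v then 1 else 0)) =
      (if C.vert i = v then (1 : ℤ) else 0) - (if C.vert (i + 1) = v then 1 else 0) := by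
    intro i
    cases h : C.fwd i
    · simp [sign, h, (C.backward i h).1, (C.backward i h).2]
    · simp [sign, h, (C.forward i h).1, (C.forward i h).2]
  have h3 : ∑ i, (if C.vert (i + 1) = v then (1 : ℤ) else 0) =
      ∑ i, if C.vert i = v then (1 : ℤ) else 0 :=
    Equiv.sum_comp (Equiv.addRight (1 : Fin (C.n + 1))) fun i => if C.vert i = v then (1 : ℤ) else 0
  rw [Finset.sum_congr rfl fun i _ => h2 i, Finset.sum_sub_distrib, h3, sub_self] at h1
  convert h1 using 2 with a
  simp only [smul_eq_mul]
  split_ifs <;> simp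

/-- Every arc of the cycle carries `h`, and its sign is that of `h`. -/
def Conforms (C : D.WeakCycle) (h : A → ℤ) : Prop :=
  ∀ i, 0 < C.sign i * h (C.arc i)

end WeakCycle

/-- A function on a nonempty finite type has a periodic orbit. -/
theorem exists_minimalPeriod_pos {X : Type*} [Finite X] [Nonempty X] (f : X → X) :
    ∃ x, 0 < Function.minimalPeriod f x := by
  obtain ⟨x0⟩ := ‹Nonempty X›
  obtain ⟨m, n, hne, heq⟩ := Finite.exists_ne_map_eq_of_infinite fun n : ℕ => f^[n] x0
  wlog hmn : m < n generalizing m n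
  · exact this n m hne.symm heq.symm (by omega)
  refine ⟨f^[m] x0, Function.IsPeriodicPt.minimalPeriod_pos (n := n - m) (by omega) ?_⟩
  simp only [Function.IsPeriodicPt, Function.IsFixedPt]
  rw [← Function.iterate_add_apply, Nat.sub_add_cancel hmn.le]
  exact heq.symm

/-- In a nonzero flow there is a conforming cycle. -/
theorem IsFlow.exists_conforms [Finite V] [Fintype A] {D : MultiDigraph V A} {h : A → ℤ}
    (hh : D.IsFlow h) (h0 : h ≠ 0) : ∃ C : D.WeakCycle, C.Conforms h := by
  classical
  -- Reverse the arcs with negative value: `src` and `tgt` are the ends of an arc of the support in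
  -- the direction in which `h` flows.
  let src (a : A) : V := if 0 < h a then D.tail a else D.head a
  let tgt (a : A) : V := if 0 < h a then D.head a else D.tail a
  -- If the flow could not continue at `tgt a`, the outflow there would be at most `0` and the
  -- inflow at least `0`. Conservation would make every term vanish, including `h a`.
  have step (a : A) (ha : h a ≠ 0) : ∃ b, h b ≠ 0 ∧ src b = tgt a := by
    by_contra! hno
    have h1 : ∀ b, D.tail b = tgt a → h b ≤ 0 := by
      intro b hb
      by_contra! hpos
      exact hno b hpos.ne' (by simp [src, hpos, hb])
    have h2 : ∀ b, D.head b = tgt a → 0 ≤ h b := by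
      intro b hb
      by_contra! hneg
      exact hno b hneg.ne (by simp [src, hneg.not_gt, hb])
    have h3 := hh (tgt a)
    have h4 : ∑ b with D.tail b = tgt a, h b ≤ 0 :=
      Finset.sum_nonpos fun b hb => h1 b (Finset.mem_filter.1 hb).2
    have h5 : 0 ≤ ∑ b with D.head b = tgt a, h b :=
      Finset.sum_nonneg fun b hb => h2 b (Finset.mem_filter.1 hb).2
    rcases ha.lt_or_gt with hlt | hgt
    · have ht : D.tail a = tgt a := by simp [tgt, hlt.not_gt]
      exact ha ((Finset.sum_eq_zero_iff_of_nonpos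
        fun b hb => h1 b (Finset.mem_filter.1 hb).2).1 (by linarith) a (by simp [ht]))
    · have ht : D.head a = tgt a := by simp [tgt, hgt]
      exact ha ((Finset.sum_eq_zero_iff_of_nonneg
        fun b hb => h2 b (Finset.mem_filter.1 hb).2).1 (by linarith) a (by simp [ht]))
  -- Choosing one outgoing arc per vertex gives a self-map of a finite set. A periodic orbit, run
  -- through for its minimal period, is the desired cycle.
  let X := {v : V // ∃ a, h a ≠ 0 ∧ src a = v}
  have out (x : X) : ∃ a, h a ≠ 0 ∧ src a = x.1 := x.2
  choose o ho hsrc using out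
  let f (x : X) : X := ⟨tgt (o x), step _ (ho x)⟩
  obtain ⟨a0, ha0⟩ := Function.ne_iff.1 h0
  have : Nonempty X := ⟨⟨src a0, a0, ha0, rfl⟩⟩
  obtain ⟨x, hx⟩ := exists_minimalPeriod_pos f
  obtain ⟨n, hn⟩ : ∃ n, Function.minimalPeriod f x = n + 1 := ⟨_, (Nat.sub_add_cancel hx).symm⟩
  let y (i : Fin (n + 1)) : X := f^[i] x
  have hy : Function.Injective y := fun i j hij =>
    Fin.ext (Function.iterate_injOn_Iio_minimalPeriod (f := f) (x := x)
      (by simpa [hn] using i.is_le) (by simpa [hn] using j.is_le) hij)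
  have hsucc (i : Fin (n + 1)) : y (i + 1) = f (y i) := by
    change f^[((i + 1 : Fin (n + 1)) : ℕ)] x = f (f^[i] x)
    rw [← Function.iterate_succ_apply' f, ← Function.iterate_mod_minimalPeriod_eq (n := i.1.succ),
      hn, Fin.val_add, Fin.val_one', Nat.add_mod_mod]
  refine ⟨{ n := n, vert := fun i => (y i).1, arc := fun i => o (y i),
            fwd := fun i => decide (0 < h (o (y i))),
            vert_injective := fun i j hij => hy (Subtype.ext hij)
            arc_injective := fun i j hij => hy (Subtype.ext ?_)
            forward := fun i hi => ?_
            backward := fun i hi => ?_ }, fun i => ?_⟩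
  · rw [← hsrc (y i), ← hsrc (y j)]
    exact congrArg src hij
  · have hi := of_decide_eq_true hi
    have h1 := hsrc (y i)
    simp only [src, hi, if_true] at h1
    refine ⟨h1, ?_⟩
    rw [hsucc]
    simp [f, tgt, hi]
  · have hi := of_decide_eq_false hi
    have h1 := hsrc (y i)
    simp only [src, hi, if_false] at h1
    refine ⟨h1, ?_⟩
    rw [hsucc]
    simp [f, tgt, hi]
  · rcases (ho (y i)).lt_or_gt with hlt | hgt
    · simp [WeakCycle.sign, hlt.not_gt, hlt]
    · simp [WeakCycle.sign, hgt]

/-- A coflow is orthogonal to every integer flow. -/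
theorem IsCoflow.sum_smul_eq_zero [Finite V] [Fintype A] [AddCommGroup M] {D : MultiDigraph V A}
    {g : A → M} (hg : D.IsCoflow g) {h : A → ℤ} (hh : D.IsFlow h) : ∑ a, h a • g a = 0 := by
  -- Subtracting a conforming cycle lowers `|h|` by one on each arc of the cycle and changes nothing
  -- elsewhere, while the pairing with `g` stays the same.
  induction hN : ∑ a, (h a).natAbs using Nat.strong_induction_on generalizing h with
  | _ N ih =>
    by_cases h0 : h = 0
    · simp [h0]
    obtain ⟨C, hC⟩ := hh.exists_conforms h0
    have hchar : ∑ a, C.char a • g a = 0 := by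
      rw [C.sum_char_smul, C.sum_sign_smul, hg C, sub_self]
    have hcases (i) : (C.sign i = 1 ∧ 0 < h (C.arc i)) ∨ (C.sign i = -1 ∧ h (C.arc i) < 0) := by
      have := hC i
      unfold WeakCycle.sign at this ⊢
      split_ifs at this ⊢
      · left; exact ⟨rfl, by linarith⟩
      · right; exact ⟨rfl, by linarith⟩
    have hlt : ∑ a, ((h - C.char) a).natAbs < N := by
      rw [← hN]
      refine Finset.sum_lt_sum (fun a _ => ?_) ⟨C.arc 0, Finset.mem_univ _, ?_⟩
      · by_cases ha : ∃ i, C.arc i = a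
        · obtain ⟨i, rfl⟩ := ha
          rw [Pi.sub_apply, C.char_arc]
          rcases hcases i with ⟨h1, h2⟩ | ⟨h1, h2⟩ <;> rw [h1] <;> omega
        · rw [Pi.sub_apply, C.char_eq_zero (not_exists.1 ha), sub_zero]
      · rw [Pi.sub_apply, C.char_arc]
        rcases hcases 0 with ⟨h1, h2⟩ | ⟨h1, h2⟩ <;> rw [h1] <;> omega
    have := ih _ hlt (hh.sub C.isFlow_char) rfl
    simpa [sub_smul, Finset.sum_sub_distrib, hchar] using this

end MultiDigraph

open Filter Topology in
/-- Near a point only those members of a finite family of closed sets are met that contain it. -/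
theorem eventually_forall_mem_of_isClosed {X ι : Type*} [TopologicalSpace X] [Finite ι]
    {K : ι → Set X} (hK : ∀ i, IsClosed (K i)) (x : X) :
    ∀ᶠ z in 𝓝 x, ∀ i, z ∈ K i → x ∈ K i := by
  rw [eventually_all]
  intro i
  by_cases hx : x ∈ K i
  · exact Eventually.of_forall fun _ _ => hx
  · filter_upwards [(hK i).isOpen_compl.mem_nhds hx] with z hz hz'
    exact absurd hz' hz

theorem isClosed_segment (p q : ℂ) : IsClosed (segment ℝ p q) := by
  rw [segment_eq_image_lineMap]
  exact (isCompact_Icc.image AffineMap.lineMap_continuous).isClosed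

/-! ### The segments of the drawing and its faces -/

namespace PlaneDigraph

variable {V A : Type*} (D : PlaneDigraph V A)

/-- The interior of an arc is injectively parametrized, for all arcs together. -/
theorem polyline_inj {a b : A} {x y : ℝ} (hx : x ∈ Ioo 0 (D.len a : ℝ))
    (hy : y ∈ Ioo 0 (D.len b : ℝ)) (h : polyline (D.corner a) x = polyline (D.corner b) y) :
    a = b ∧ x = y := by
  by_cases hab : a = b
  · subst hab
    exact ⟨rfl, D.interior_injOn a hx hy h⟩
  · exact absurd ⟨y, hy, h.symm⟩
      (Set.disjoint_left.1 (D.interior_disjoint a b hab) ⟨x, hx, rfl⟩)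

/-- A point of an arc is one of its ends or an inner point. -/
theorem polyline_cases {b : A} {y : ℝ} (h0 : 0 ≤ y) (h1 : y ≤ D.len b) :
    polyline (D.corner b) y ∈ range D.pos ∨ y ∈ Ioo 0 (D.len b : ℝ) := by
  rcases h0.eq_or_lt with rfl | h0
  · left
    refine ⟨D.tail b, ?_⟩
    rw [← D.corner_zero]
    simpa using (polyline_natCast (D.corner b) 0).symm
  rcases h1.eq_or_lt with rfl | h1
  · left
    refine ⟨D.head b, ?_⟩
    rw [← D.corner_len]
    exact (polyline_natCast (D.corner b) _).symm
  · exact Or.inr ⟨h0, h1⟩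

/-- An inner point of an arc lies on an arc only for the obvious reason. -/
theorem polyline_inj_of_mem {a b : A} {x y : ℝ} (hx : x ∈ Ioo 0 (D.len a : ℝ))
    (hy0 : 0 ≤ y) (hy1 : y ≤ D.len b)
    (h : polyline (D.corner a) x = polyline (D.corner b) y) : a = b ∧ x = y := by
  rcases D.polyline_cases hy0 hy1 with ⟨v, hv⟩ | hy
  · exact absurd ⟨x, hx, h.trans hv.symm⟩ (D.pos_notMem_interior v a)
  · exact D.polyline_inj hx hy h

/-- The segments of the drawing: `⟨a, k⟩` runs from `corner a k` to `corner a (k + 1)`. -/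
abbrev Seg : Type _ := Σ a, Fin (D.len a)

/-- The first point of a segment. -/
def src (s : D.Seg) : ℂ := D.corner s.1 s.2

/-- The last point of a segment. -/
def tgt (s : D.Seg) : ℂ := D.corner s.1 (s.2 + 1)

theorem exists_polyline_of_mem_openSegment {s : D.Seg} {z : ℂ}
    (hz : z ∈ openSegment ℝ (D.src s) (D.tgt s)) :
    ∃ t ∈ Ioo (0 : ℝ) 1, polyline (D.corner s.1) (s.2 + t) = z := by
  rw [openSegment_eq_image_lineMap] at hz
  obtain ⟨t, ht, rfl⟩ := hz
  exact ⟨t, ht, polyline_of_mem _ _ _ ht.1.le ht.2⟩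

theorem seg_succ_le (s : D.Seg) : ((s.2 : ℕ) : ℝ) + 1 ≤ D.len s.1 := by
  exact_mod_cast s.2.isLt

theorem seg_add_mem_Ioo (s : D.Seg) {t : ℝ} (ht : t ∈ Ioo (0 : ℝ) 1) :
    (s.2 : ℝ) + t ∈ Ioo 0 (D.len s.1 : ℝ) := by
  have h1 := D.seg_succ_le s
  have h0 : (0 : ℝ) ≤ (s.2 : ℕ) := Nat.cast_nonneg _
  exact ⟨by linarith [ht.1], by linarith [ht.2]⟩

theorem src_ne_tgt (s : D.Seg) : D.src s ≠ D.tgt s := by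
  intro h
  have e (t : ℝ) (ht : t ∈ Ioo (0 : ℝ) 1) : polyline (D.corner s.1) (s.2 + t) = D.src s := by
    rw [polyline_of_mem _ _ _ ht.1.le ht.2]
    change AffineMap.lineMap (D.src s) (D.tgt s) t = _
    rw [← h, AffineMap.lineMap_same_apply]
  have h2 : (1 / 2 : ℝ) ∈ Ioo (0 : ℝ) 1 := by norm_num
  have h3 : (1 / 3 : ℝ) ∈ Ioo (0 : ℝ) 1 := by norm_num
  have := (D.polyline_inj (D.seg_add_mem_Ioo s h2) (D.seg_add_mem_Ioo s h3)
    ((e _ h2).trans (e _ h3).symm)).2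
  norm_num at this

/-- Inner points of segments lie on no other segment. -/
theorem eq_of_mem_openSegment {s s' : D.Seg} {z : ℂ}
    (hz : z ∈ openSegment ℝ (D.src s) (D.tgt s)) (hz' : z ∈ segment ℝ (D.src s') (D.tgt s')) :
    s' = s ∧ z ≠ D.src s' ∧ z ≠ D.tgt s' := by
  -- The curves are injective, so the two parameters agree; `k + t` with `0 < t < 1` lies in `[l, l
  -- + 1]` only if `l = k`, and then it is neither end.
  have main {s s' : D.Seg} {x t : ℝ} (ht : t ∈ Ioo (0 : ℝ) 1) (h0 : (s'.2 : ℝ) ≤ x)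
      (h1 : x ≤ s'.2 + 1)
      (h : polyline (D.corner s.1) (s.2 + t) = polyline (D.corner s'.1) x) :
      s' = s ∧ x ≠ s'.2 ∧ x ≠ s'.2 + 1 := by
    obtain ⟨h2, h3⟩ := D.polyline_inj_of_mem (D.seg_add_mem_Ioo s ht)
      ((Nat.cast_nonneg _).trans h0) (h1.trans (D.seg_succ_le s')) h
    obtain ⟨a, k⟩ := s
    obtain ⟨b, l⟩ := s'
    dsimp only at h2 h3 h0 h1
    subst h2
    have h4 : (l : ℕ) < (k : ℕ) + 1 := by
      have : ((l : ℕ) : ℝ) < (k : ℕ) + 1 := by linarith [ht.2]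
      exact_mod_cast this
    have h5 : (k : ℕ) < (l : ℕ) + 1 := by
      have : ((k : ℕ) : ℝ) < (l : ℕ) + 1 := by linarith [ht.1]
      exact_mod_cast this
    have h6 : l = k := Fin.ext (by omega)
    subst h6
    exact ⟨rfl, by dsimp only; linarith [ht.1], by dsimp only; linarith [ht.2]⟩
  obtain ⟨t, ht, rfl⟩ := D.exists_polyline_of_mem_openSegment hz
  obtain ⟨x, h0, h1, hx⟩ := exists_polyline_eq _ _ hz'
  refine ⟨(main ht h0 h1 hx.symm).1, fun h => ?_, fun h => ?_⟩
  · refine (main (s' := s') ht le_rfl (by linarith) (h.trans ?_)).2.1 rfl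
    exact (polyline_natCast _ _).symm
  · refine (main (s' := s') ht (by linarith) le_rfl (h.trans ?_)).2.2 rfl
    exact_mod_cast (polyline_natCast (D.corner s'.1) (s'.2 + 1)).symm

theorem pos_notMem_openSegment (v : V) (s : D.Seg) :
    D.pos v ∉ openSegment ℝ (D.src s) (D.tgt s) := by
  intro h
  obtain ⟨t, ht, h⟩ := D.exists_polyline_of_mem_openSegment h
  exact D.pos_notMem_interior v s.1 ⟨_, D.seg_add_mem_Ioo s ht, h⟩

theorem mem_drawing_iff {z : ℂ} :
    z ∈ D.drawing ↔ (∃ v, D.pos v = z) ∨ ∃ s : D.Seg, z ∈ segment ℝ (D.src s) (D.tgt s) := by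
  unfold drawing
  rw [mem_union, mem_range, mem_iUnion]
  constructor
  · rintro (h | ⟨a, x, ⟨h0, h1⟩, rfl⟩)
    · exact Or.inl h
    · rcases h1.lt_or_eq with h1 | rfl
      · exact Or.inr ⟨⟨a, ⌊x⌋₊, (Nat.floor_lt h0).2 h1⟩, polyline_mem_segment _ h0⟩
      · exact Or.inl ⟨D.head a, by rw [polyline_natCast, D.corner_len]⟩
  · rintro (h | ⟨s, hs⟩)
    · exact Or.inl h
    · obtain ⟨x, h0, h1, hx⟩ := exists_polyline_eq _ _ hs
      exact Or.inr ⟨s.1, x, ⟨(Nat.cast_nonneg _).trans h0, h1.trans (D.seg_succ_le s)⟩, hx⟩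

theorem isClosed_drawing [Finite V] [Finite A] : IsClosed D.drawing := by
  have : D.drawing = range D.pos ∪ ⋃ s : D.Seg, segment ℝ (D.src s) (D.tgt s) := by
    ext z
    rw [mem_drawing_iff]
    simp
  rw [this]
  exact (Set.finite_range _).isClosed.union (isClosed_iUnion_of_finite fun s => isClosed_segment _ _)

open Filter Topology in
/-- Near a point the drawing consists of the vertices and segments that contain this point. -/
theorem eventually_mem_drawing [Finite V] [Finite A] (x : ℂ) :
    ∀ᶠ z in 𝓝 x, z ∈ D.drawing → (z = x ∧ ∃ v, D.pos v = x) ∨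
      ∃ s : D.Seg, z ∈ segment ℝ (D.src s) (D.tgt s) ∧ x ∈ segment ℝ (D.src s) (D.tgt s) := by
  filter_upwards [eventually_forall_mem_of_isClosed
      (fun s : D.Seg => isClosed_segment (D.src s) (D.tgt s)) x,
    eventually_forall_mem_of_isClosed (K := fun v : V => {D.pos v})
      (fun v => isClosed_singleton) x] with z h1 h2 hz
  rcases D.mem_drawing_iff.1 hz with ⟨v, rfl⟩ | ⟨s, hs⟩
  · have := h2 v rfl
    exact Or.inl ⟨this.symm, v, this.symm⟩
  · exact Or.inr ⟨s, hs, h1 s hs⟩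

/-- The first segment of an arc. -/
def firstSeg (a : A) : D.Seg := ⟨a, 0, D.len_pos a⟩

theorem src_firstSeg (a : A) : D.src (D.firstSeg a) = D.corner a 0 := rfl

theorem tgt_firstSeg (a : A) : D.tgt (D.firstSeg a) = D.corner a 1 := rfl

theorem sidePoint_zero_mem (a : A) :
    D.sidePoint a 0 ∈ openSegment ℝ (D.src (D.firstSeg a)) (D.tgt (D.firstSeg a)) := by
  rw [openSegment_eq_image_lineMap]
  refine ⟨1 / 2, by norm_num, ?_⟩
  rw [src_firstSeg, tgt_firstSeg, AffineMap.lineMap_apply, sidePoint]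
  simp only [vsub_eq_sub, vadd_eq_add, Complex.real_smul]
  push_cast
  ring

theorem continuous_sidePoint (a : A) : Continuous (D.sidePoint a) := by
  unfold sidePoint
  fun_prop

/-- The face of a point off the drawing. -/
noncomputable def faceOf {z : ℂ} (hz : z ∉ D.drawing) : D.Face := ConnectedComponents.mk ⟨z, hz⟩

theorem faceOf_eq {S : Set ℂ} (hS : S ⊆ D.drawingᶜ) (hS' : IsPreconnected S) {x y : ℂ}
    (hx : x ∈ S) (hy : y ∈ S) : D.faceOf (hS hx) = D.faceOf (hS hy) := by
  refine ConnectedComponents.coe_eq_coe'.2 ?_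
  have h : IsPreconnected ((↑) ⁻¹' S : Set ↥(D.drawing)ᶜ) := by
    refine (Topology.IsInducing.subtypeVal.isPreconnected_image).1 ?_
    rwa [Subtype.image_preimage_coe, inter_eq_right.2 hS]
  have h1 : (⟨x, hS hx⟩ : ↥(D.drawing)ᶜ) ∈ ((↑) ⁻¹' S : Set ↥(D.drawing)ᶜ) := hx
  have h2 : (⟨y, hS hy⟩ : ↥(D.drawing)ᶜ) ∈ ((↑) ⁻¹' S : Set ↥(D.drawing)ᶜ) := hy
  exact h.subset_connectedComponent h2 h1

section Faces

variable [Finite V] [Finite A]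

/-- A function that is constant on preconnected sets that avoid the drawing has the same values
on all points of the perpendicular on one side. -/
theorem eq_leftFace_side {M : Type*} {u : ℂ → M}
    (hu : ∀ S ⊆ D.drawingᶜ, IsPreconnected S → ∀ x ∈ S, ∀ y ∈ S, u x = u y) (a : A) {t : ℝ}
    (ht : t ∈ Ioc 0 (D.sideDist a)) :
    u (D.sidePoint a (D.sideDist a)) = u (D.sidePoint a t) ∧
      u (D.sidePoint a (-D.sideDist a)) = u (D.sidePoint a (-t)) := by
  have h := D.sideDist_pos a
  constructor
  · refine hu (D.sidePoint a '' Ioc 0 (D.sideDist a)) ?_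
      (isPreconnected_Ioc.image _ (D.continuous_sidePoint a).continuousOn) _
      ⟨_, ⟨h, le_rfl⟩, rfl⟩ _ ⟨_, ht, rfl⟩
    rintro _ ⟨r, hr, rfl⟩
    exact D.sidePoint_notMem a hr.1.ne' (by rw [abs_of_pos hr.1]; exact hr.2)
  · refine hu ((fun r => D.sidePoint a (-r)) '' Ioc 0 (D.sideDist a)) ?_
      (isPreconnected_Ioc.image _ ((D.continuous_sidePoint a).comp continuous_neg).continuousOn) _
      ⟨_, ⟨h, le_rfl⟩, rfl⟩ _ ⟨_, ht, rfl⟩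
    rintro _ ⟨r, hr, rfl⟩
    exact D.sidePoint_notMem a (neg_ne_zero.2 hr.1.ne') (by rw [abs_neg, abs_of_pos hr.1]; exact hr.2)

end Faces

end PlaneDigraph

/-! ### Winding numbers: every flow has a face potential -/

/-- A segment is seen from a point off the segment under an angle different from `π`. -/
theorem div_mem_slitPlane_of_notMem_segment {p q z : ℂ} (h : z ∉ segment ℝ p q) :
    (q - z) / (p - z) ∈ Complex.slitPlane := by
  have hp : p - z ≠ 0 := fun h' => h (by rw [← sub_eq_zero.1 h']; exact left_mem_segment ℝ p q)
  by_contra hs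
  rw [Complex.mem_slitPlane_iff, not_or, not_lt, not_not] at hs
  set r := ((q - z) / (p - z)).re with hr
  have h1 : (q - z) / (p - z) = r := Complex.ext rfl (by simpa using hs.2)
  rw [div_eq_iff hp] at h1
  have h3 : (1 : ℝ) - r ≠ 0 := by linarith
  have h3' : (1 : ℂ) - r ≠ 0 := by exact_mod_cast h3
  -- Solving `q - z = r (p - z)` with `r ≤ 0` for `z` gives a convex combination of `p` and `q`.
  refine h ⟨-r / (1 - r), 1 / (1 - r), div_nonneg (by linarith) (by linarith),
    div_nonneg one_pos.le (by linarith), by field_simp; ring, ?_⟩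
  simp only [Complex.real_smul]
  push_cast
  field_simp
  linear_combination h1

namespace PlaneDigraph

variable {V A : Type*} (D : PlaneDigraph V A)

/-- The signed angle under which a segment is seen from a point. -/
noncomputable def segAngle (s : D.Seg) (z : ℂ) : ℝ :=
  Complex.arg ((D.tgt s - z) / (D.src s - z))

theorem continuousAt_segAngle {s : D.Seg} {z : ℂ} (hz : z ∉ segment ℝ (D.src s) (D.tgt s)) :
    ContinuousAt (D.segAngle s) z := by
  have hp : D.src s - z ≠ 0 := fun h' =>
    hz (by rw [← sub_eq_zero.1 h']; exact left_mem_segment ℝ _ _)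
  refine ContinuousAt.comp (f := fun z => (D.tgt s - z) / (D.src s - z)) (g := Complex.arg)
    (Complex.continuousAt_arg (div_mem_slitPlane_of_notMem_segment hz)) ?_
  fun_prop (disch := exact hp)

/-- The angles under which the segments of an arc are seen add up to that of its ends. -/
theorem coe_sum_segAngle (a : A) {z : ℂ} (hz : z ∉ D.drawing) :
    ((∑ k, D.segAngle ⟨a, k⟩ z : ℝ) : Real.Angle) =
      (Complex.arg (D.pos (D.head a) - z) : Real.Angle) - Complex.arg (D.pos (D.tail a) - z) := by
  have hne (k : ℕ) (hk : k ≤ D.len a) : D.corner a k - z ≠ 0 := by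
    intro h
    refine hz (Or.inr (mem_iUnion.2 ⟨a, k, ⟨Nat.cast_nonneg _, by exact_mod_cast hk⟩, ?_⟩))
    rw [polyline_natCast, ← sub_eq_zero.1 h]
  have h1 : (∑ k, D.segAngle ⟨a, k⟩ z : ℝ) = ∑ k ∈ Finset.range (D.len a),
      Complex.arg ((D.corner a (k + 1) - z) / (D.corner a k - z)) :=
    Fin.sum_univ_eq_sum_range
      (fun k => Complex.arg ((D.corner a (k + 1) - z) / (D.corner a k - z))) _
  have h2 : ((∑ k ∈ Finset.range (D.len a),
      Complex.arg ((D.corner a (k + 1) - z) / (D.corner a k - z)) : ℝ) : Real.Angle) =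
      ∑ k ∈ Finset.range (D.len a), ((Complex.arg (D.corner a (k + 1) - z) : Real.Angle) -
        Complex.arg (D.corner a k - z)) := by
    rw [← Real.Angle.coe_coeHom, map_sum]
    refine Finset.sum_congr rfl fun k hk => ?_
    rw [Real.Angle.coe_coeHom]
    exact Complex.arg_div_coe_angle (hne _ (Finset.mem_range.1 hk)) (hne _ (Finset.mem_range.1 hk).le)
  rw [h1, h2, Finset.sum_range_sub (fun k => (Complex.arg (D.corner a k - z) : Real.Angle)),
    D.corner_len, D.corner_zero]

-- This is the jump of `arg` across the negative real axis: seen from the midpoint, the two ends lie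
-- in opposite directions.
open Filter Topology in
theorem tendsto_segAngle_firstSeg (a : A) :
    Tendsto (fun t => D.segAngle (D.firstSeg a) (D.sidePoint a t)) (𝓝[>] 0) (𝓝 Real.pi) ∧
    Tendsto (fun t => D.segAngle (D.firstSeg a) (D.sidePoint a (-t))) (𝓝[>] 0)
      (𝓝 (-Real.pi)) := by
  have hd : D.corner a 1 - D.corner a 0 ≠ 0 := sub_ne_zero.2 (D.corner_zero_ne_one a).symm
  -- In coordinates where the segment runs from `-1/2` to `1/2`, the side point is `t * I`. The
  -- quotient `r t` tends to `-1`, and its imaginary part has the sign of `t`.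
  let r (t : ℝ) : ℂ := (1 / 2 - t * Complex.I) / (-(1 / 2) - t * Complex.I)
  have hden (t : ℝ) : (-(1 / 2) - t * Complex.I : ℂ) ≠ 0 := by
    intro h
    have := congrArg Complex.re h
    simp at this
  have hr (t : ℝ) : D.segAngle (D.firstSeg a) (D.sidePoint a t) = Complex.arg (r t) := by
    unfold segAngle
    rw [src_firstSeg, tgt_firstSeg, sidePoint]
    congr 1
    have h1 : D.corner a 1 - ((D.corner a 0 + D.corner a 1) / 2 +
        t * (Complex.I * (D.corner a 1 - D.corner a 0))) =
        (1 / 2 - t * Complex.I) * (D.corner a 1 - D.corner a 0) := by ring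
    have h2 : D.corner a 0 - ((D.corner a 0 + D.corner a 1) / 2 +
        t * (Complex.I * (D.corner a 1 - D.corner a 0))) =
        (-(1 / 2) - t * Complex.I) * (D.corner a 1 - D.corner a 0) := by ring
    rw [h1, h2, mul_div_mul_right _ _ hd]
  have hcont : Continuous r := by
    refine Continuous.div (by fun_prop) (by fun_prop) hden
  have hr0 : r 0 = -1 := by
    simp only [r]
    norm_num
  have him (t : ℝ) : (r t).im = t / (1 / 4 + t ^ 2) := by
    simp only [r, Complex.div_im, Complex.normSq_apply]
    simp
    have : (1 / 4 + t ^ 2 : ℝ) ≠ 0 := by positivity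
    have h' : (2⁻¹ * 2⁻¹ + t * t : ℝ) ≠ 0 := by nlinarith [mul_self_nonneg t]
    field_simp
    ring
  have hlim : Tendsto r (𝓝 0) (𝓝 (-1)) := by
    have := hcont.tendsto 0
    rwa [hr0] at this
  have hre : (-1 : ℂ).re < 0 := by simp
  have him1 : (-1 : ℂ).im = 0 := by simp
  constructor
  · simp only [hr]
    refine (Complex.tendsto_arg_nhdsWithin_im_nonneg_of_re_neg_of_im_zero hre him1).comp
      (tendsto_nhdsWithin_iff.2 ⟨hlim.mono_left nhdsWithin_le_nhds, ?_⟩)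
    filter_upwards [self_mem_nhdsWithin] with t ht
    rw [him]
    have : (0 : ℝ) < t := ht
    positivity
  · simp only [hr]
    refine (Complex.tendsto_arg_nhdsWithin_im_neg_of_re_neg_of_im_zero hre him1).comp
      (tendsto_nhdsWithin_iff.2 ⟨?_, ?_⟩)
    · refine (hlim.comp ?_).mono_left nhdsWithin_le_nhds
      have := (continuous_neg (G := ℝ)).tendsto 0
      rwa [neg_zero] at this
    · filter_upwards [self_mem_nhdsWithin] with t ht
      rw [him, neg_div, neg_lt_zero]
      have : (0 : ℝ) < t := ht
      positivity

section Winding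

variable [Fintype A]

/-- The total signed angle, with weights `h`, under which the arcs are seen from a point. -/
noncomputable def totalAngle (h : A → ℤ) (z : ℂ) : ℝ :=
  ∑ s : D.Seg, h s.1 • D.segAngle s z

/-- Modulo `2π` the angles along an arc telescope to a difference of arguments at its ends, so the
total is the pairing of a flow with a coboundary. -/
theorem totalAngle_mem {h : A → ℤ} (hh : D.toMultiDigraph.IsFlow h) {z : ℂ}
    (hz : z ∉ D.drawing) : D.totalAngle h z ∈ AddSubgroup.zmultiples (2 * Real.pi) := by
  rw [AddSubgroup.mem_zmultiples_iff, ← Real.Angle.coe_eq_zero_iff, totalAngle,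
    ← Finset.univ_sigma_univ, Finset.sum_sigma]
  simp only [← Finset.smul_sum]
  rw [← Real.Angle.coe_coeHom, map_sum,
    ← hh.sum_smul_sub fun v => (Complex.arg (D.pos v - z) : Real.Angle)]
  refine Finset.sum_congr rfl fun a _ => ?_
  rw [map_zsmul, Real.Angle.coe_coeHom, D.coe_sum_segAngle a hz]

open Filter Topology in
theorem continuousOn_totalAngle (h : A → ℤ) : ContinuousOn (D.totalAngle h) D.drawingᶜ := by
  intro z hz
  refine ContinuousAt.continuousWithinAt ?_
  refine tendsto_finsetSum _ fun s _ => ?_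
  have h1 : Tendsto (D.segAngle s) (𝓝 z) (𝓝 (D.segAngle s z)) :=
    D.continuousAt_segAngle fun hs => hz (D.mem_drawing_iff.2 (Or.inr ⟨s, hs⟩))
  exact h1.const_smul (h s.1)

/-- A continuous function with values in the discrete group `2πℤ` is constant on preconnected sets.
-/
theorem totalAngle_eq {h : A → ℤ} (hh : D.toMultiDigraph.IsFlow h) (S : Set ℂ)
    (hS : S ⊆ D.drawingᶜ) (hS' : IsPreconnected S) (x : ℂ) (hx : x ∈ S) (y : ℂ) (hy : y ∈ S) :
    D.totalAngle h x = D.totalAngle h y :=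
  hS'.constant_of_mapsTo (T := (AddSubgroup.zmultiples (2 * Real.pi) : Set ℝ))
    (SetLike.isDiscrete_iff_discreteTopology.2 inferInstance)
    ((D.continuousOn_totalAngle h).mono hS) (fun _ hz => D.totalAngle_mem hh (hS hz)) hx hy

-- Only the first segment of `a` contains the midpoint, so all other summands are continuous there
-- and their differences tend to `0`.
open Filter Topology in
theorem tendsto_totalAngle_sub (h : A → ℤ) (a : A) :
    Tendsto (fun t => D.totalAngle h (D.sidePoint a t) - D.totalAngle h (D.sidePoint a (-t)))
      (𝓝[>] 0) (𝓝 (h a * (2 * Real.pi))) := by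
  classical
  have hlim : h a * (2 * Real.pi) =
      ∑ s : D.Seg, if s = D.firstSeg a then h a * (2 * Real.pi) else 0 := by simp
  rw [hlim]
  simp only [totalAngle, ← Finset.sum_sub_distrib, ← smul_sub]
  refine tendsto_finsetSum _ fun s _ => ?_
  split_ifs with hs
  · subst hs
    have h1 := D.tendsto_segAngle_firstSeg a
    have h2 := (h1.1.sub h1.2).const_smul (h a)
    rwa [sub_neg_eq_add, ← two_mul, zsmul_eq_mul] at h2
  · have hz : D.sidePoint a 0 ∉ segment ℝ (D.src s) (D.tgt s) := fun hz =>
      hs (D.eq_of_mem_openSegment (D.sidePoint_zero_mem a) hz).1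
    have hc : ContinuousAt (fun t => D.segAngle s (D.sidePoint a t)) 0 :=
      ContinuousAt.comp (f := D.sidePoint a) (D.continuousAt_segAngle hz)
        (D.continuous_sidePoint a).continuousAt
    have hc' : Tendsto (fun t => D.segAngle s (D.sidePoint a (-t))) (𝓝 0)
        (𝓝 (D.segAngle s (D.sidePoint a 0))) := by
      refine Tendsto.comp (f := fun t : ℝ => -t) (g := fun t => D.segAngle s (D.sidePoint a t))
        hc ?_
      have := (continuous_neg (G := ℝ)).tendsto 0
      rwa [neg_zero] at this
    have h2 := ((Tendsto.sub hc hc').const_smul (h s.1)).mono_left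
      (nhdsWithin_le_nhds (s := Ioi 0))
    simpa using h2

/-- Every integer flow is the coboundary of a function on the faces. -/
theorem exists_face_potential [Finite V] {h : A → ℤ} (hh : D.toMultiDigraph.IsFlow h) :
    ∃ φ : D.Face → ℤ, ∀ a, φ (D.leftFace a) - φ (D.rightFace a) = h a := by
  have hpi : (2 * Real.pi) ≠ 0 := by positivity
  have hF (F : D.Face) : ∃ n : ℤ, ∀ z, ∀ hz : z ∉ D.drawing, D.faceOf hz = F →
      D.totalAngle h z = n * (2 * Real.pi) := by
    obtain ⟨⟨z0, hz0⟩, rfl⟩ := ConnectedComponents.surjective_coe F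
    obtain ⟨n, hn⟩ := AddSubgroup.mem_zmultiples_iff.1 (D.totalAngle_mem hh hz0)
    refine ⟨n, fun z hz hzF => ?_⟩
    rw [← zsmul_eq_mul, hn]
    have h1 : (⟨z, hz⟩ : ↥(D.drawing)ᶜ) ∈ connectedComponent ⟨z0, hz0⟩ :=
      ConnectedComponents.coe_eq_coe'.1 hzF
    refine D.totalAngle_eq hh (Subtype.val '' connectedComponent (⟨z0, hz0⟩ : ↥(D.drawing)ᶜ)) ?_
      (isPreconnected_connectedComponent.image _ continuous_subtype_val.continuousOn)
      _ ⟨_, h1, rfl⟩ _ ⟨_, mem_connectedComponent, rfl⟩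
    rintro _ ⟨w, -, rfl⟩
    exact w.2
  choose φ hφ using hF
  refine ⟨φ, fun a => ?_⟩
  have h1 := hφ (D.leftFace a) _ _ rfl
  have h2 := hφ (D.rightFace a) _ _ rfl
  -- For small `t > 0` the difference does not depend on `t`, so it equals its limit.
  have h3 := tendsto_nhds_unique (D.tendsto_totalAngle_sub h a)
    (tendsto_const_nhds.congr' (f₁ := fun _ => (φ (D.leftFace a) - φ (D.rightFace a) : ℝ) *
      (2 * Real.pi)) (by
      filter_upwards [Ioc_mem_nhdsGT (D.sideDist_pos a)] with t ht
      obtain ⟨h4, h5⟩ := D.eq_leftFace_side (D.totalAngle_eq hh) a ht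
      rw [← h4, ← h5, h1, h2]
      ring))
  have h4 := mul_right_cancel₀ hpi h3
  exact_mod_cast h4.symm

end Winding

end PlaneDigraph

/-! ### Jumps of locally constant functions around a point -/

section SideValues

open Filter Topology

/-- A function on the line that is locally constant near every point, apart from this point, is
constant up to isolated points. -/
theorem exists_eventually_eq_of_forall_punctured {M : Type*} {F : ℝ → M}
    (hF : ∀ x, ∃ c, ∀ᶠ y in 𝓝[≠] x, F y = c) : ∃ c, ∀ x, ∀ᶠ y in 𝓝[≠] x, F y = c := by
  choose G hG using hF
  -- Points `y` near `x` have punctured neighbourhoods on which `F` equals both `G y` and `G x`.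
  have hloc : IsLocallyConstant G := by
    rw [IsLocallyConstant.iff_eventually_eq]
    intro x
    have h1 : ∀ᶠ y in 𝓝 x, y ≠ x → F y = G x := eventually_nhdsWithin_iff.1 (hG x)
    filter_upwards [h1.eventually_nhds] with y hy
    by_cases hyx : y = x
    · rw [hyx]
    have h2 : ∀ᶠ z in 𝓝[≠] y, F z = G x := by
      filter_upwards [hy.filter_mono nhdsWithin_le_nhds,
        (isOpen_ne.mem_nhds hyx : {z | z ≠ x} ∈ 𝓝 y) |> mem_nhdsWithin_of_mem_nhds] with z h3 h4
      exact h3 h4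
    obtain ⟨z, h3, h4⟩ := ((hG y).and h2).exists
    exact h3.symm.trans h4
  exact ⟨G 0, fun x => by rw [hloc.apply_eq_of_preconnectedSpace 0 x]; exact hG x⟩

/-- `⌊(x - t) / T⌋` jumps by `1` at the points `t + n * T`. -/
theorem eventually_floor (t T x : ℝ) (hT : 0 < T) :
    ∃ l r : ℤ, (∀ᶠ y in 𝓝[<] x, ⌊(y - t) / T⌋ = l) ∧ (∀ᶠ y in 𝓝[>] x, ⌊(y - t) / T⌋ = r) ∧
      (((∃ n : ℤ, x = t + n * T) → r - l = 1) ∧ ((¬ ∃ n : ℤ, x = t + n * T) → r - l = 0)) := by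
  by_cases h : ∃ n : ℤ, x = t + n * T
  · obtain ⟨n, rfl⟩ := h
    refine ⟨n - 1, n, ?_, ?_, fun _ => by ring, fun h => absurd ⟨n, rfl⟩ h⟩
    · filter_upwards [Ioo_mem_nhdsLT (show t + n * T - T < t + n * T by linarith)] with y hy
      rw [Int.floor_eq_iff, le_div_iff₀ hT, div_lt_iff₀ hT]
      push_cast
      exact ⟨by linarith [hy.1], by linarith [hy.2]⟩
    · filter_upwards [Ioo_mem_nhdsGT (show t + n * T < t + n * T + T by linarith)] with y hy
      rw [Int.floor_eq_iff, le_div_iff₀ hT, div_lt_iff₀ hT]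
      exact ⟨by linarith [hy.1], by linarith [hy.2]⟩
  · have hev : ∀ᶠ y in 𝓝 x, ⌊(y - t) / T⌋ = ⌊(x - t) / T⌋ := by
      have h1 := Int.floor_le ((x - t) / T)
      have h2 := Int.lt_floor_add_one ((x - t) / T)
      have h3 : (⌊(x - t) / T⌋ : ℝ) < (x - t) / T := by
        refine lt_of_le_of_ne h1 fun he => h ⟨⌊(x - t) / T⌋, ?_⟩
        rw [he]
        field_simp
        ring
      have hc : ContinuousAt (fun y : ℝ => (y - t) / T) x := by fun_prop
      filter_upwards [hc.eventually (Ioo_mem_nhds h3 h2)] with y hy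
      rw [Int.floor_eq_iff]
      exact ⟨hy.1.le, hy.2⟩
    exact ⟨_, _, hev.filter_mono nhdsWithin_le_nhds, hev.filter_mono nhdsWithin_le_nhds,
      fun h' => absurd h' h, fun _ => sub_self _⟩

open Classical in
/-- The jumps of a piecewise constant periodic function over one period add up to zero. -/
theorem sum_jumps_eq_zero {ι : Type*} [Fintype ι] (θ : ι → ℝ) (J : ι → ℤ) {T : ℝ} (hT : 0 < T)
    {ψ : ℝ → ℤ} (hper : ∀ x, ψ (x + T) = ψ x)
    (hψ : ∀ x, ∃ l r, (∀ᶠ y in 𝓝[<] x, ψ y = l) ∧ (∀ᶠ y in 𝓝[>] x, ψ y = r) ∧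
      r - l = ∑ i, if ∃ n : ℤ, x = θ i + n * T then J i else 0) : ∑ i, J i = 0 := by
  -- Subtracting staircases with the same jumps leaves a function that is constant up to isolated
  -- points. A shift by `T` changes it by `-∑ J i`, which must therefore vanish.
  set F : ℝ → ℤ := fun x => ψ x - ∑ i, J i * ⌊(x - θ i) / T⌋ with hFdef
  have hF : ∀ x, ∃ c, ∀ᶠ y in 𝓝[≠] x, F y = c := by
    intro x
    obtain ⟨l, r, hl, hr, hlr⟩ := hψ x
    choose l' r' hl' hr' hlr' using fun i => eventually_floor (θ i) T x hT
    have key : r - ∑ i, J i * r' i = l - ∑ i, J i * l' i := by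
      have : ∑ i, J i * r' i - ∑ i, J i * l' i =
          ∑ i, if ∃ n : ℤ, x = θ i + n * T then J i else 0 := by
        rw [← Finset.sum_sub_distrib]
        refine Finset.sum_congr rfl fun i _ => ?_
        rw [← mul_sub]
        split_ifs with h
        · rw [(hlr' i).1 h, mul_one]
        · rw [(hlr' i).2 h, mul_zero]
      linarith
    refine ⟨l - ∑ i, J i * l' i, ?_⟩
    rw [← Iio_union_Ioi, nhdsWithin_union, eventually_sup]
    constructor
    · filter_upwards [hl, eventually_all.2 hl'] with y h1 h2
      simp only [hFdef, h1, h2]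
    · filter_upwards [hr, eventually_all.2 hr'] with y h1 h2
      simp only [hFdef, h1, h2, key]
  obtain ⟨c, hc⟩ := exists_eventually_eq_of_forall_punctured hF
  have hshift (x : ℝ) : F (x + T) = F x - ∑ i, J i := by
    have hfl (i : ι) : ⌊(x + T - θ i) / T⌋ = ⌊(x - θ i) / T⌋ + 1 := by
      rw [← Int.floor_add_one]
      congr 1
      field_simp
      ring
    simp only [hFdef, hper, hfl, mul_add, mul_one, Finset.sum_add_distrib]
    ring
  have h1 : ∀ᶠ y in 𝓝[>] (0 : ℝ), F (y + T) = c := by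
    have h2 : Tendsto (fun y => y + T) (𝓝[>] (0 : ℝ)) (𝓝[≠] T) := by
      refine tendsto_nhdsWithin_iff.2 ⟨?_, ?_⟩
      · have : Continuous fun y : ℝ => y + T := by fun_prop
        have := this.tendsto 0
        rw [zero_add] at this
        exact this.mono_left nhdsWithin_le_nhds
      · filter_upwards [self_mem_nhdsWithin] with y hy
        have : (0 : ℝ) < y := hy
        simp [this.ne']
    exact h2.eventually (hc T)
  have h2 : ∀ᶠ y in 𝓝[>] (0 : ℝ), F y = c :=
    (hc 0).filter_mono (nhdsWithin_mono _ fun y (hy : 0 < y) => hy.ne')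
  obtain ⟨y, h3, h4⟩ := (h1.and h2).exists
  have := hshift y
  omega

/-- A function takes the values `L` and `R` immediately to the left and to the right of the open
segment from `x` to `x + e`. -/
def HasSideValues {M : Type*} (u : ℂ → M) (x e : ℂ) (L R : M) : Prop :=
  ∀ y ∈ openSegment ℝ x (x + e), ∀ᶠ z in 𝓝 y,
    (0 < ((z - x) / e).im → u z = L) ∧ (((z - x) / e).im < 0 → u z = R)

/-- This allows a segment that ends at a point to be treated as one that leaves it. -/
theorem HasSideValues.reverse {M : Type*} {u : ℂ → M} {x e : ℂ} {L R : M} (he : e ≠ 0)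
    (h : HasSideValues u x e L R) : HasSideValues u (x + e) (-e) R L := by
  intro y hy
  rw [add_neg_cancel_right, openSegment_symm] at hy
  have hz (z : ℂ) : (z - (x + e)) / -e = 1 - (z - x) / e := by
    field_simp
    ring
  filter_upwards [h y hy] with z h1
  rw [hz, Complex.sub_im, Complex.one_im, zero_sub, neg_pos, neg_lt_zero]
  exact ⟨h1.2, h1.1⟩

theorem convex_im_pos_inter_ball (w : ℂ) (ε : ℝ) :
    Convex ℝ (Metric.ball w ε ∩ {z | 0 < z.im}) :=
  (convex_ball w ε).inter (convex_halfSpace_im_gt 0)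

/-- Values on one side of an open unit interval. -/
theorem exists_eventually_eq_of_im_pos {M : Type*} {K : Set ℂ} {u : ℂ → M}
    (hu : ∀ S ⊆ Kᶜ, IsPreconnected S → ∀ x ∈ S, ∀ y ∈ S, u x = u y)
    (hK : ∀ t ∈ Ioo (0 : ℝ) 1, ∀ᶠ z in 𝓝 (t : ℂ), z ∈ K → z.im = 0) :
    ∃ L, ∀ t ∈ Ioo (0 : ℝ) 1, ∀ᶠ z in 𝓝 (t : ℂ), 0 < z.im → u z = L := by
  -- Near `t` the set `K` lies on the real axis, so a small upper half-disc avoids it, and this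
  -- half-disc is convex.
  have h1 (t : Ioo (0 : ℝ) 1) : ∃ L, ∀ᶠ z in 𝓝 ((t : ℝ) : ℂ), 0 < z.im → u z = L := by
    obtain ⟨ε, hε, h⟩ := Metric.eventually_nhds_iff_ball.1 (hK t t.2)
    have hmem : ((t : ℝ) : ℂ) + (ε / 2 : ℝ) * Complex.I ∈
        Metric.ball ((t : ℝ) : ℂ) ε ∩ {z | 0 < z.im} := by
      constructor
      · rw [Metric.mem_ball, dist_eq_norm, add_sub_cancel_left, norm_mul, Complex.norm_I, mul_one,
          Complex.norm_real, Real.norm_of_nonneg (by positivity)]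
        linarith
      · simpa using hε
    refine ⟨u (((t : ℝ) : ℂ) + (ε / 2 : ℝ) * Complex.I), ?_⟩
    filter_upwards [Metric.ball_mem_nhds _ hε] with z hz hz'
    exact hu _ (fun w hw hwK => hw.2.ne' (h w hw.1 hwK))
      (convex_im_pos_inter_ball ((t : ℝ) : ℂ) ε).isPreconnected _ ⟨hz, hz'⟩ _ hmem
  choose L hL using h1
  -- The half-discs of neighbouring points overlap.
  have hloc : IsLocallyConstant L := by
    rw [IsLocallyConstant.iff_eventually_eq]
    intro t
    have hc : Continuous fun s : Ioo (0 : ℝ) 1 => ((s : ℝ) : ℂ) := by fun_prop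
    filter_upwards [hc.continuousAt.eventually (hL t).eventually_nhds] with s hs
    obtain ⟨ε, hε, h⟩ := Metric.eventually_nhds_iff_ball.1 (hs.and (hL s))
    have hb : ((s : ℝ) : ℂ) + (ε / 2 : ℝ) * Complex.I ∈ Metric.ball ((s : ℝ) : ℂ) ε := by
      rw [Metric.mem_ball, dist_eq_norm, add_sub_cancel_left, norm_mul, Complex.norm_I, mul_one,
        Complex.norm_real, Real.norm_of_nonneg (by positivity)]
      linarith
    have hp : 0 < (((s : ℝ) : ℂ) + (ε / 2 : ℝ) * Complex.I).im := by simpa using hε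
    exact ((h _ hb).2 hp).symm.trans ((h _ hb).1 hp)
  have : PreconnectedSpace (Ioo (0 : ℝ) 1) := Subtype.preconnectedSpace isPreconnected_Ioo
  refine ⟨L ⟨1 / 2, by norm_num⟩, fun t ht => ?_⟩
  rw [hloc.apply_eq_of_preconnectedSpace ⟨1 / 2, by norm_num⟩ ⟨t, ht⟩]
  exact hL ⟨t, ht⟩

/-- A function that is constant on the preconnected sets that avoid `K` has side values along a
segment near which `K` is contained in the line through the segment. -/
theorem exists_hasSideValues {M : Type*} {K : Set ℂ} {u : ℂ → M}
    (hu : ∀ S ⊆ Kᶜ, IsPreconnected S → ∀ x ∈ S, ∀ y ∈ S, u x = u y) {x e : ℂ} (he : e ≠ 0)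
    (hK : ∀ y ∈ openSegment ℝ x (x + e), ∀ᶠ z in 𝓝 y, z ∈ K → ((z - x) / e).im = 0) :
    ∃ L R, HasSideValues u x e L R := by
  -- The left side is the upper side of the unit interval under `w ↦ x + f * w`. The right side is
  -- the left side of the reversed segment.
  have main (f : ℂ) (hf : f ≠ 0) (x : ℂ)
      (hK : ∀ y ∈ openSegment ℝ x (x + f), ∀ᶠ z in 𝓝 y, z ∈ K → ((z - x) / f).im = 0) :
      ∃ L, ∀ y ∈ openSegment ℝ x (x + f), ∀ᶠ z in 𝓝 y, 0 < ((z - x) / f).im → u z = L := by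
    have hc : Continuous fun w : ℂ => x + f * w := by fun_prop
    have hseg (t : ℝ) (ht : t ∈ Ioo (0 : ℝ) 1) : x + f * t ∈ openSegment ℝ x (x + f) := by
      rw [openSegment_eq_image_lineMap]
      refine ⟨t, ht, ?_⟩
      rw [AffineMap.lineMap_apply]
      simp only [vsub_eq_sub, vadd_eq_add, Complex.real_smul]
      ring
    obtain ⟨L, hL⟩ := exists_eventually_eq_of_im_pos (K := (fun w => x + f * w) ⁻¹' K)
      (u := fun w => u (x + f * w))
      (fun S hS hS' a ha b hb => hu ((fun w => x + f * w) '' S)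
        (by rintro _ ⟨w, hw, rfl⟩; exact hS hw) (hS'.image _ hc.continuousOn)
        _ ⟨a, ha, rfl⟩ _ ⟨b, hb, rfl⟩)
      (fun t ht => by
        filter_upwards [hc.continuousAt.eventually (hK _ (hseg t ht))] with w hw hwK
        have := hw hwK
        rwa [add_sub_cancel_left, mul_div_cancel_left₀ _ hf] at this)
    refine ⟨L, fun y hy => ?_⟩
    rw [openSegment_eq_image_lineMap] at hy
    obtain ⟨t, ht, rfl⟩ := hy
    have hty : (AffineMap.lineMap x (x + f) t - x) / f = (t : ℂ) := by
      rw [AffineMap.lineMap_apply]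
      simp only [vsub_eq_sub, vadd_eq_add, Complex.real_smul, add_sub_cancel_left,
        add_sub_cancel_right]
      field_simp
    have hc' : Continuous fun z : ℂ => (z - x) / f := by fun_prop
    have h1 := hc'.tendsto (AffineMap.lineMap x (x + f) t)
    rw [hty] at h1
    replace h1 := h1.eventually (hL t ht)
    filter_upwards [h1] with z hz hz'
    have := hz hz'
    rwa [mul_div_cancel₀ _ hf, add_sub_cancel] at this
  obtain ⟨L, hL⟩ := main e he x hK
  have hz (z : ℂ) : (z - (x + e)) / -e = 1 - (z - x) / e := by
    field_simp
    ring
  obtain ⟨R, hR⟩ := main (-e) (neg_ne_zero.2 he) (x + e) (by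
    intro y hy
    rw [add_neg_cancel_right, openSegment_symm] at hy
    filter_upwards [hK y hy] with z h1 h2
    rw [hz, Complex.sub_im, h1 h2]
    simp)
  refine ⟨L, R, fun y hy => ?_⟩
  filter_upwards [hL y hy,
    hR y (by rw [add_neg_cancel_right, openSegment_symm]; exact hy)] with z h1 h2
  refine ⟨h1, fun h3 => h2 ?_⟩
  rw [hz, Complex.sub_im, Complex.one_im, zero_sub, neg_pos]
  exact h3

/-- The jumps of a locally constant function at the segments that leave a point add up to zero. -/
theorem sum_sideValues_eq_zero {ι : Type*} [Fintype ι] {K : Set ℂ} (hKc : IsClosed K) {u : ℂ → ℤ}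
    (hu : ∀ S ⊆ Kᶜ, IsPreconnected S → ∀ x ∈ S, ∀ y ∈ S, u x = u y) (x : ℂ) (e : ι → ℂ)
    (he : ∀ i, e i ≠ 0)
    (hdisj : ∀ i j z, z ∈ openSegment ℝ x (x + e i) → z ∈ openSegment ℝ x (x + e j) → i = j)
    (hK : ∀ᶠ z in 𝓝 x, z ∈ K → z = x ∨ ∃ i, z ∈ segment ℝ x (x + e i)) (L R : ι → ℤ)
    (hLR : ∀ i, HasSideValues u x (e i) (L i) (R i)) : ∑ i, (L i - R i) = 0 := by
  obtain ⟨ε, hε, hball⟩ := Metric.eventually_nhds_iff_ball.1 hK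
  have hev1 : ∀ᶠ ρ in 𝓝[>] (0 : ℝ), ρ ∈ Ioo 0 ε := Ioo_mem_nhdsGT hε
  have hev2 : ∀ᶠ ρ in 𝓝[>] (0 : ℝ), ∀ i, ρ ∈ Ioo 0 ‖e i‖ :=
    eventually_all.2 fun i => Ioo_mem_nhdsGT (norm_pos_iff.2 (he i))
  -- The circle of radius `ρ` meets every segment before its far end and stays where `K` consists
  -- only of these segments and possibly `x`.
  obtain ⟨ρ, ⟨hρ, hρε⟩, hρe⟩ := (hev1.and hev2).exists
  have hρ' : (ρ : ℂ) ≠ 0 := by exact_mod_cast hρ.ne'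
  have hne (i : ι) : (‖e i‖ : ℂ) ≠ 0 := by exact_mod_cast (norm_pos_iff.2 (he i)).ne'
  let γ (t : ℝ) : ℂ := x + ρ * Complex.exp (t * Complex.I)
  have hγ : Continuous γ := by fun_prop
  have hexp (i : ι) (t : ℝ) (h : ∃ n : ℤ, t = Complex.arg (e i) + n * (2 * Real.pi)) :
      e i = ‖e i‖ * Complex.exp (t * Complex.I) := by
    obtain ⟨n, rfl⟩ := h
    conv_lhs => rw [← Complex.norm_mul_exp_arg_mul_I (e i)]
    congr 1
    rw [Complex.exp_eq_exp_iff_exists_int]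
    exact ⟨-n, by push_cast; ring⟩
  have hray (i : ι) (t : ℝ) (h : ∃ n : ℤ, t = Complex.arg (e i) + n * (2 * Real.pi)) :
      γ t ∈ openSegment ℝ x (x + e i) := by
    rw [openSegment_eq_image_lineMap]
    refine ⟨ρ / ‖e i‖, ⟨div_pos hρ (hρ.trans (hρe i).2), (div_lt_one (hρ.trans (hρe i).2)).2
      (hρe i).2⟩, ?_⟩
    rw [AffineMap.lineMap_apply]
    simp only [vsub_eq_sub, vadd_eq_add, Complex.real_smul, add_sub_cancel_left, γ]
    have h1 : (ρ : ℂ) / ‖e i‖ * e i = ρ * Complex.exp (t * Complex.I) := by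
      rw [div_mul_eq_mul_div, div_eq_iff (hne i)]
      linear_combination (ρ : ℂ) * hexp i t h
    push_cast
    rw [h1, add_comm]
  refine sum_jumps_eq_zero (fun i => Complex.arg (e i)) (fun i => L i - R i)
    (T := 2 * Real.pi) (by positivity) (ψ := fun t => u (γ t)) (fun t => ?_) (fun t => ?_)
  · have : γ (t + 2 * Real.pi) = γ t := by
      simp only [γ]
      congr 2
      rw [Complex.exp_eq_exp_iff_exists_int]
      exact ⟨1, by push_cast; ring⟩
    simp only [this]
  by_cases h : ∃ i, ∃ n : ℤ, t = Complex.arg (e i) + n * (2 * Real.pi)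
  · obtain ⟨i, hi⟩ := h
    have hev := hγ.continuousAt.eventually (hLR i (γ t) (hray i t hi))
    -- The sign is that of `sin (y - t)`: anticlockwise, the circle passes from the right of the
    -- segment to its left.
    have him (y : ℝ) : ((γ y - x) / e i).im = ρ / ‖e i‖ * Real.sin (y - t) := by
      have : (γ y - x) / e i = (ρ / ‖e i‖ : ℝ) * Complex.exp ((y - t : ℝ) * Complex.I) := by
        have h2 : Complex.exp ((y - t : ℝ) * Complex.I) =
            Complex.exp (y * Complex.I) / Complex.exp (t * Complex.I) := by
          rw [← Complex.exp_sub]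
          congr 1
          push_cast
          ring
        conv_lhs => rw [hexp i t hi]
        rw [h2]
        simp only [γ, add_sub_cancel_left]
        push_cast
        rw [mul_div_mul_comm]
      rw [this, Complex.im_ofReal_mul, Complex.exp_ofReal_mul_I_im]
    have hpos : 0 < ρ / ‖e i‖ := div_pos hρ (hρ.trans (hρe i).2)
    refine ⟨R i, L i, ?_, ?_, ?_⟩
    · filter_upwards [hev.filter_mono nhdsWithin_le_nhds,
        Ioo_mem_nhdsLT (show t - Real.pi < t by linarith [Real.pi_pos])] with y h1 h2
      refine h1.2 ?_
      rw [him]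
      exact mul_neg_of_pos_of_neg hpos
        (Real.sin_neg_of_neg_of_neg_pi_lt (by linarith [h2.2]) (by linarith [h2.1]))
    · filter_upwards [hev.filter_mono nhdsWithin_le_nhds,
        Ioo_mem_nhdsGT (show t < t + Real.pi by linarith [Real.pi_pos])] with y h1 h2
      refine h1.1 ?_
      rw [him]
      exact mul_pos hpos (Real.sin_pos_of_pos_of_lt_pi (by linarith [h2.1]) (by linarith [h2.2]))
    · rw [Finset.sum_eq_single i (fun j _ hj => if_neg fun hj' =>
        hj (hdisj j i _ (hray j t hj') (hray i t hi))) (fun h => absurd (Finset.mem_univ i) h),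
        if_pos hi]
  -- A point of the circle in `K` would lie on some segment, and `t` would be the argument of its
  -- direction modulo `2π`.
  · have hγK : γ t ∉ K := by
      intro hK'
      have hdist : dist (γ t) x = ρ := by
        simp [γ, Complex.norm_exp_ofReal_mul_I, abs_of_pos hρ]
      rcases hball (γ t) (by rw [Metric.mem_ball, hdist]; exact hρε) hK' with h1 | ⟨i, h1⟩
      · rw [h1, dist_self] at hdist
        exact hρ.ne hdist
      · rw [segment_eq_image_lineMap] at h1
        obtain ⟨s, ⟨hs0, -⟩, h1⟩ := h1
        rw [AffineMap.lineMap_apply] at h1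
        simp only [vsub_eq_sub, vadd_eq_add, Complex.real_smul, add_sub_cancel_left, γ] at h1
        have h2 : (ρ : ℂ) * Complex.exp (t * Complex.I) = s * e i := by linear_combination -h1
        have h3 : ρ = s * ‖e i‖ := by
          have := congrArg norm h2
          rwa [norm_mul, norm_mul, Complex.norm_exp_ofReal_mul_I, Complex.norm_real,
            Complex.norm_real, Real.norm_of_nonneg hρ.le, Real.norm_of_nonneg hs0, mul_one] at this
        rw [← Complex.norm_mul_exp_arg_mul_I (e i), ← mul_assoc, ← Complex.ofReal_mul, ← h3] at h2
        obtain ⟨n, hn⟩ := Complex.exp_eq_exp_iff_exists_int.1 (mul_left_cancel₀ hρ' h2)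
        refine h ⟨i, n, ?_⟩
        have h4 : (t : ℂ) = Complex.arg (e i) + n * (2 * Real.pi) :=
          mul_right_cancel₀ Complex.I_ne_zero (by linear_combination hn)
        exact_mod_cast h4
    obtain ⟨δ, hδ, hsub⟩ := Metric.isOpen_iff.1 hKc.isOpen_compl _ hγK
    have hev : ∀ᶠ y in 𝓝 t, u (γ y) = u (γ t) := by
      filter_upwards [hγ.continuousAt.eventually (Metric.ball_mem_nhds (γ t) hδ)] with y hy
      exact hu _ hsub (convex_ball _ _).isPreconnected _ hy _ (Metric.mem_ball_self hδ)
    refine ⟨_, _, hev.filter_mono nhdsWithin_le_nhds, hev.filter_mono nhdsWithin_le_nhds, ?_⟩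
    rw [sub_self, Finset.sum_eq_zero fun i _ => if_neg fun hi => h ⟨i, hi⟩]

end SideValues

/-! ### The coboundary of a face function is a flow -/

namespace PlaneDigraph

variable {V A : Type*} (D : PlaneDigraph V A)

open Filter Topology

/-- The last segment of an arc. -/
def lastSeg (a : A) : D.Seg := ⟨a, D.len a - 1, Nat.sub_lt (D.len_pos a) one_pos⟩

theorem corner_notMem_openSegment (a : A) {k : ℕ} (hk : k ≤ D.len a) (s : D.Seg) :
    D.corner a k ∉ openSegment ℝ (D.src s) (D.tgt s) := by
  intro h
  rcases hk.eq_or_lt with rfl | hk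
  · rw [D.corner_len] at h
    exact D.pos_notMem_openSegment _ _ h
  · have h1 : D.corner a k ∈ segment ℝ (D.src ⟨a, k, hk⟩) (D.tgt ⟨a, k, hk⟩) :=
      left_mem_segment ℝ _ _
    exact (D.eq_of_mem_openSegment h h1).2.1 rfl

/-- An inner corner of an arc is a corner only for the obvious reason. -/
theorem corner_inj {a b : A} {k l : ℕ} (hk : 0 < k) (hk' : k < D.len a) (hl : l ≤ D.len b)
    (h : D.corner a k = D.corner b l) : a = b ∧ k = l := by
  obtain ⟨h1, h2⟩ := D.polyline_inj_of_mem (x := k) (y := l)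
    ⟨by exact_mod_cast hk, by exact_mod_cast hk'⟩ (Nat.cast_nonneg _) (by exact_mod_cast hl)
    (by rw [polyline_natCast, polyline_natCast, h])
  exact ⟨h1, by exact_mod_cast h2⟩

theorem pos_ne_corner (v : V) {a : A} {k : ℕ} (hk : 0 < k) (hk' : k < D.len a) :
    D.corner a k ≠ D.pos v := by
  intro h
  exact D.pos_notMem_interior v a
    ⟨k, ⟨by exact_mod_cast hk, by exact_mod_cast hk'⟩, by rw [polyline_natCast, h]⟩

theorem src_eq_pos_iff (v : V) (s : D.Seg) :
    D.src s = D.pos v ↔ s = D.firstSeg s.1 ∧ D.tail s.1 = v := by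
  obtain ⟨a, k, hk⟩ := s
  constructor
  · intro h
    rcases Nat.eq_zero_or_pos k with rfl | hk0
    · refine ⟨rfl, D.pos_injective ?_⟩
      rw [← h, ← D.corner_zero]
      rfl
    · exact absurd h (D.pos_ne_corner v hk0 hk)
  · rintro ⟨h, rfl⟩
    rw [h, src_firstSeg, D.corner_zero]
    rfl

theorem tgt_eq_pos_iff (v : V) (s : D.Seg) :
    D.tgt s = D.pos v ↔ s = D.lastSeg s.1 ∧ D.head s.1 = v := by
  obtain ⟨a, k, hk⟩ := s
  have hlast (hk' : k + 1 = D.len a) : (⟨a, k, hk⟩ : D.Seg) = D.lastSeg a := by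
    unfold lastSeg
    congr
    omega
  have htgt : D.tgt (D.lastSeg a) = D.pos (D.head a) := by
    rw [← D.corner_len]
    exact congrArg (D.corner a) (Nat.sub_add_cancel (D.len_pos a))
  constructor
  · intro h
    rcases (Nat.succ_le_of_lt hk).eq_or_lt with hk' | hk'
    · refine ⟨hlast hk', D.pos_injective ?_⟩
      rw [← h, hlast hk', htgt]
      rfl
    · exact absurd h (D.pos_ne_corner v k.succ_pos hk')
  · rintro ⟨h, rfl⟩
    rw [h]
    exact htgt

section SideValues

variable [Finite V] [Fintype A]

theorem exists_seg_hasSideValues {M : Type*} {u : ℂ → M}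
    (hu : ∀ S ⊆ D.drawingᶜ, IsPreconnected S → ∀ x ∈ S, ∀ y ∈ S, u x = u y) (s : D.Seg) :
    ∃ L R, HasSideValues u (D.src s) (D.tgt s - D.src s) L R := by
  have he : D.tgt s - D.src s ≠ 0 := sub_ne_zero.2 (D.src_ne_tgt s).symm
  refine exists_hasSideValues hu he fun y hy => ?_
  rw [add_sub_cancel] at hy
  filter_upwards [D.eventually_mem_drawing y] with z hz hzK
  rcases hz hzK with ⟨-, v, rfl⟩ | ⟨s', hzs, hys⟩
  · exact absurd hy (D.pos_notMem_openSegment v s)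
  · obtain ⟨rfl, -⟩ := D.eq_of_mem_openSegment hy hys
    rw [segment_eq_image_lineMap] at hzs
    obtain ⟨t, -, rfl⟩ := hzs
    rw [AffineMap.lineMap_apply]
    simp only [vsub_eq_sub, vadd_eq_add, Complex.real_smul, add_sub_cancel_right]
    rw [mul_div_cancel_right₀ _ he, Complex.ofReal_im]

open Classical in
/-- At every point the jumps at the segments that end there match those at the segments that
start there. -/
theorem sum_src_eq_sum_tgt {u : ℂ → ℤ}
    (hu : ∀ S ⊆ D.drawingᶜ, IsPreconnected S → ∀ x ∈ S, ∀ y ∈ S, u x = u y) {L R : D.Seg → ℤ}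
    (hLR : ∀ s, HasSideValues u (D.src s) (D.tgt s - D.src s) (L s) (R s)) {x : ℂ}
    (hx : ∀ s, x ∉ openSegment ℝ (D.src s) (D.tgt s)) :
    ∑ s with D.src s = x, (L s - R s) = ∑ s with D.tgt s = x, (L s - R s) := by
  have hne (s : D.Seg) : D.tgt s - D.src s ≠ 0 := sub_ne_zero.2 (D.src_ne_tgt s).symm
  -- The segments at `x`, all directed away from `x`. Those that end at `x` are reversed, which
  -- exchanges their sides and changes the sign of their jumps.
  let seg : {s // D.src s = x} ⊕ {s // D.tgt s = x} → D.Seg :=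
    Sum.elim Subtype.val Subtype.val
  let e : {s // D.src s = x} ⊕ {s // D.tgt s = x} → ℂ :=
    Sum.elim (fun s => D.tgt s - D.src s) (fun s => D.src s - D.tgt s)
  have hopen (i) : openSegment ℝ x (x + e i) = openSegment ℝ (D.src (seg i)) (D.tgt (seg i)) := by
    rcases i with ⟨s, rfl⟩ | ⟨s, rfl⟩
    · simp [e, seg]
    · rw [openSegment_symm]
      simp [e, seg]
  have hclosed (i) : segment ℝ x (x + e i) = segment ℝ (D.src (seg i)) (D.tgt (seg i)) := by
    rcases i with ⟨s, rfl⟩ | ⟨s, rfl⟩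
    · simp [e, seg]
    · rw [segment_symm]
      simp [e, seg]
  have hseg : Function.Injective seg := by
    rintro (⟨s, hs⟩ | ⟨s, hs⟩) (⟨s', hs'⟩ | ⟨s', hs'⟩) (h : s = s')
    · subst h; rfl
    · subst h; exact absurd (hs.trans hs'.symm) (D.src_ne_tgt s)
    · subst h; exact absurd (hs'.trans hs.symm) (D.src_ne_tgt s)
    · subst h; rfl
  have key := sum_sideValues_eq_zero D.isClosed_drawing hu x e
    (by
      rintro (s | s)
      · exact hne s
      · exact sub_ne_zero.2 (D.src_ne_tgt s))
    (fun i j z hi hj => by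
      rw [hopen] at hi hj
      exact (hseg (D.eq_of_mem_openSegment hi (openSegment_subset_segment _ _ _ hj)).1).symm)
    (by
      filter_upwards [D.eventually_mem_drawing x] with z hz hzK
      rcases hz hzK with ⟨rfl, -⟩ | ⟨s, hzs, hxs⟩
      · exact Or.inl rfl
      rw [← insert_endpoints_openSegment] at hxs
      rcases hxs with h | h | h
      · exact Or.inr ⟨Sum.inl ⟨s, h.symm⟩, by rw [hclosed]; exact hzs⟩
      · exact Or.inr ⟨Sum.inr ⟨s, h.symm⟩, by rw [hclosed]; exact hzs⟩
      · exact absurd h (hx s))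
    (Sum.elim (fun s => L s) (fun s => R s)) (Sum.elim (fun s => R s) (fun s => L s))
    (by
      rintro (⟨s, rfl⟩ | ⟨s, rfl⟩)
      · exact hLR s
      · have := (hLR s).reverse (hne s)
        rwa [add_sub_cancel, neg_sub] at this)
  rw [Fintype.sum_sum_type] at key
  simp only [Sum.elim_inl, Sum.elim_inr] at key
  rw [← Finset.sum_subtype_eq_sum_filter, ← Finset.sum_subtype_eq_sum_filter,
    Finset.subtype_univ, Finset.subtype_univ, ← sub_eq_zero, ← key, sub_eq_add_neg,
    ← Finset.sum_neg_distrib]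
  simp only [neg_sub]

/-- The jump of a locally constant function is the same at all segments of an arc. -/
theorem jump_eq_firstSeg {u : ℂ → ℤ}
    (hu : ∀ S ⊆ D.drawingᶜ, IsPreconnected S → ∀ x ∈ S, ∀ y ∈ S, u x = u y) {L R : D.Seg → ℤ}
    (hLR : ∀ s, HasSideValues u (D.src s) (D.tgt s - D.src s) (L s) (R s)) (a : A) (k : ℕ)
    (hk : k < D.len a) :
    L ⟨a, k, hk⟩ - R ⟨a, k, hk⟩ = L (D.firstSeg a) - R (D.firstSeg a) := by
  classical
  induction k with
  | zero => rfl
  | succ k ih =>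
    rw [← ih (Nat.lt_of_succ_lt hk)]
    -- At an inner corner exactly one segment ends and exactly one starts, so the balance is an
    -- equality of two jumps.
    have h := D.sum_src_eq_sum_tgt hu hLR (D.corner_notMem_openSegment a hk.le)
    rw [Finset.sum_eq_single ⟨a, k + 1, hk⟩, Finset.sum_eq_single ⟨a, k, Nat.lt_of_succ_lt hk⟩] at h
    · exact h
    · rintro ⟨b, l, hl⟩ hs hne
      obtain ⟨rfl, h2⟩ := D.corner_inj k.succ_pos hk (Nat.succ_le_of_lt hl)
        (Finset.mem_filter.1 hs).2.symm
      obtain rfl : k = l := by omega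
      exact absurd rfl hne
    · intro h'
      exact (h' (by rw [Finset.mem_filter_univ]; rfl)).elim
    · rintro ⟨b, l, hl⟩ hs hne
      obtain ⟨rfl, rfl⟩ := D.corner_inj k.succ_pos hk hl.le (Finset.mem_filter.1 hs).2.symm
      exact absurd rfl hne
    · intro h'
      exact (h' (by rw [Finset.mem_filter_univ]; rfl)).elim

/-- The side values along the first segment of an arc are those in its left and right faces. -/
theorem sideValues_firstSeg {M : Type*} {u : ℂ → M}
    (hu : ∀ S ⊆ D.drawingᶜ, IsPreconnected S → ∀ x ∈ S, ∀ y ∈ S, u x = u y) (a : A) {L R : M}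
    (hLR : HasSideValues u (D.src (D.firstSeg a))
      (D.tgt (D.firstSeg a) - D.src (D.firstSeg a)) L R) :
    u (D.sidePoint a (D.sideDist a)) = L ∧ u (D.sidePoint a (-D.sideDist a)) = R := by
  have hne : D.corner a 1 - D.corner a 0 ≠ 0 := sub_ne_zero.2 (D.corner_zero_ne_one a).symm
  have h1 := hLR (D.sidePoint a 0) (by rw [add_sub_cancel]; exact D.sidePoint_zero_mem a)
  have him (t : ℝ) : ((D.sidePoint a t - D.src (D.firstSeg a)) /
      (D.tgt (D.firstSeg a) - D.src (D.firstSeg a))).im = t := by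
    rw [src_firstSeg, tgt_firstSeg, sidePoint]
    have : ((D.corner a 0 + D.corner a 1) / 2 + t * (Complex.I * (D.corner a 1 - D.corner a 0)) -
        D.corner a 0) / (D.corner a 1 - D.corner a 0) = 1 / 2 + t * Complex.I := by
      rw [div_eq_iff hne]
      ring
    rw [this]
    simp
  have h2 := (D.continuous_sidePoint a).continuousAt.eventually h1
  simp only [him] at h2
  obtain ⟨ε, hε, hball⟩ := Metric.eventually_nhds_iff_ball.1 h2
  have hev1 : ∀ᶠ t in 𝓝[>] (0 : ℝ), t ∈ Ioc 0 (D.sideDist a) :=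
    Ioc_mem_nhdsGT (D.sideDist_pos a)
  have hev2 : ∀ᶠ t in 𝓝[>] (0 : ℝ), t ∈ Ioo 0 ε := Ioo_mem_nhdsGT hε
  obtain ⟨t, ht, htε⟩ := (hev1.and hev2).exists
  obtain ⟨h3, h4⟩ := D.eq_leftFace_side hu a ht
  rw [h3, h4]
  have hb (r : ℝ) (hr : |r| = t) : r ∈ Metric.ball (0 : ℝ) ε := by
    rw [Metric.mem_ball, Real.dist_eq, sub_zero, hr]
    exact htε.2
  exact ⟨(hball t (hb t (abs_of_pos ht.1))).1 ht.1,
    (hball (-t) (hb _ (by rw [abs_neg, abs_of_pos ht.1]))).2 (neg_lt_zero.2 ht.1)⟩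

/-- The coboundary of a function on the faces is a flow. -/
theorem isFlow_face_sub (φ : D.Face → ℤ) :
    D.toMultiDigraph.IsFlow fun a => φ (D.leftFace a) - φ (D.rightFace a) := by
  classical
  -- The value on the drawing is immaterial: `hu` concerns only points off it.
  let u (z : ℂ) : ℤ := if h : z ∉ D.drawing then φ (D.faceOf h) else 0
  have hu0 {z : ℂ} (h : z ∉ D.drawing) : u z = φ (D.faceOf h) := dif_pos h
  have hu : ∀ S ⊆ D.drawingᶜ, IsPreconnected S → ∀ x ∈ S, ∀ y ∈ S, u x = u y := by
    intro S hS hS' x hx y hy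
    rw [hu0 (hS hx), hu0 (hS hy), D.faceOf_eq hS hS' hx hy]
  choose L R hLR using D.exists_seg_hasSideValues hu
  have hfirst (a : A) : φ (D.leftFace a) - φ (D.rightFace a) =
      L (D.firstSeg a) - R (D.firstSeg a) := by
    obtain ⟨h1, h2⟩ := D.sideValues_firstSeg hu a (hLR _)
    rw [← h1, ← h2, hu0, hu0]
    rfl
  have hlast (a : A) : L (D.lastSeg a) - R (D.lastSeg a) =
      L (D.firstSeg a) - R (D.firstSeg a) := D.jump_eq_firstSeg hu hLR a _ _
  intro v
  simp only [hfirst]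
  -- At a vertex the segments that start are first segments of outgoing arcs, and those that end are
  -- last segments of incoming arcs.
  have h := D.sum_src_eq_sum_tgt hu hLR (fun s => D.pos_notMem_openSegment v s)
  simp only [src_eq_pos_iff, tgt_eq_pos_iff] at h
  convert h using 1
  · refine Finset.sum_bij' (fun a _ => D.firstSeg a) (fun s _ => s.1) ?_ ?_ ?_ ?_ ?_
    · intro a ha
      exact Finset.mem_filter.2 ⟨Finset.mem_univ _, rfl, (Finset.mem_filter.1 ha).2⟩
    · intro s hs
      exact Finset.mem_filter.2 ⟨Finset.mem_univ _, (Finset.mem_filter.1 hs).2.2⟩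
    · exact fun _ _ => rfl
    · exact fun s hs => (Finset.mem_filter.1 hs).2.1.symm
    · exact fun _ _ => rfl
  · refine Finset.sum_bij' (fun a _ => D.lastSeg a) (fun s _ => s.1) ?_ ?_ ?_ ?_ ?_
    · intro a ha
      exact Finset.mem_filter.2 ⟨Finset.mem_univ _, rfl, (Finset.mem_filter.1 ha).2⟩
    · intro s hs
      exact Finset.mem_filter.2 ⟨Finset.mem_univ _, (Finset.mem_filter.1 hs).2.2⟩
    · exact fun _ _ => rfl
    · exact fun s hs => (Finset.mem_filter.1 hs).2.1.symm
    · exact fun a _ => (hlast a).symm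

end SideValues

end PlaneDigraph

/-! ### Directed cycles and total cyclicity -/

namespace MultiDigraph

variable {V A : Type*} {D : MultiDigraph V A}

/-- A directed cycle of `D` that avoids `S` is a directed cycle of `D - S`. -/
theorem IsFeedbackArcSet.exists_mem {S : Set A} (hS : D.IsFeedbackArcSet S) (C : D.WeakCycle)
    (hC : C.IsDirected) : ∃ i, C.arc i ∈ S := by
  by_contra! h
  exact hS ⟨{ n := C.n, vert := C.vert, arc := fun i => ⟨C.arc i, h i⟩, fwd := C.fwd,
              vert_injective := C.vert_injective
              arc_injective := fun i j hij => C.arc_injective (congrArg Subtype.val hij)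
              forward := C.forward, backward := C.backward }, hC⟩

/-- A weak cycle of `D - S` as one of `D`. -/
def WeakCycle.ofDeleteArcs {S : Set A} (C : (D.deleteArcs S).WeakCycle) : D.WeakCycle where
  n := C.n
  vert := C.vert
  arc i := (C.arc i).1
  fwd := C.fwd
  vert_injective := C.vert_injective
  arc_injective := Subtype.val_injective.comp C.arc_injective
  forward := C.forward
  backward := C.backward

theorem WeakCycle.IsDirected.sign_eq_one {C : D.WeakCycle} (hC : C.IsDirected) (i) :
    C.sign i = 1 := if_pos (hC i)

theorem WeakCycle.IsDirected.char_nonneg {C : D.WeakCycle} (hC : C.IsDirected) (a : A) :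
    0 ≤ C.char a := by
  by_cases ha : ∃ i, C.arc i = a
  · obtain ⟨i, rfl⟩ := ha
    rw [C.char_arc, hC.sign_eq_one]
    exact zero_le_one
  · rw [C.char_eq_zero (not_exists.1 ha)]

/-- A digraph is totally cyclic if every arc lies on a closed directed walk. -/
theorem isTotallyCyclic_of_forall_arc
    (h : ∀ a, Relation.ReflTransGen D.Adj (D.head a) (D.tail a)) : D.IsTotallyCyclic := by
  have key (u v : V) (huv : Relation.EqvGen D.Adj u v) :
      Relation.ReflTransGen D.Adj u v ∧ Relation.ReflTransGen D.Adj v u := by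
    induction huv with
    | rel u v huv =>
      refine ⟨.single huv, ?_⟩
      obtain ⟨a, rfl, rfl⟩ := huv
      exact h a
    | refl u => exact ⟨.refl, .refl⟩
    | symm u v _ ih => exact ih.symm
    | trans u v w _ _ ih1 ih2 => exact ⟨ih1.1.trans ih2.1, ih2.2.trans ih1.2⟩
  exact fun u v huv => (key u v huv).1

end MultiDigraph

/-! ### Duality of coflows and flows, and of directed cycles and cuts -/

namespace PlaneDigraph

variable {V A : Type*} [Finite V] [Fintype A] (D : PlaneDigraph V A) {g : A → ℤ}

/-- The signed characteristic function of a cycle has a face potential `φ`, and a flow of `D*` is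
orthogonal to the coboundary of `φ`. Dual arcs run from left to right, whence the minus sign. -/
theorem isCoflow_of_isFlow_dual (hg : D.dual.IsFlow g) : D.toMultiDigraph.IsCoflow g := by
  intro C
  obtain ⟨φ, hφ⟩ := D.exists_face_potential C.isFlow_char
  rw [← sub_eq_zero, ← C.sum_sign_smul, ← C.sum_char_smul, ← neg_eq_zero,
    ← hg.sum_smul_sub φ, ← Finset.sum_neg_distrib]
  refine Finset.sum_congr rfl fun a _ => ?_
  rw [← hφ]
  change -((φ (D.leftFace a) - φ (D.rightFace a)) * g a) =
    g a * (φ (D.rightFace a) - φ (D.leftFace a))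
  ring

/-- Conservation at a face `F` is orthogonality to the coboundary of the indicator of `F`, which is
a flow of `D`. -/
theorem isFlow_dual_of_isCoflow (hg : D.toMultiDigraph.IsCoflow g) : D.dual.IsFlow g := by
  classical
  intro F
  have h := hg.sum_smul_eq_zero (D.isFlow_face_sub fun F' => if F' = F then 1 else 0)
  simp only [sub_smul, Finset.sum_sub_distrib, ite_smul, one_smul, zero_smul] at h
  rw [← Finset.sum_filter, ← Finset.sum_filter, sub_eq_zero] at h
  convert h <;> rfl

/-- If the head of a dual arc `a0` does not reach its tail in the contraction, the set reachable
from the head bounds a directed cut avoiding `T`. Its coboundary is a nonnegative nonzero flow of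
`D`; a conforming cycle is directed and avoids `S`. -/
theorem isTotallyCyclic_dual_of_isFeedbackArcSet {T S : Set A} (hST : S ⊆ T)
    (hS : D.toMultiDigraph.IsFeedbackArcSet S) : (D.dual.contractArcs T).IsTotallyCyclic := by
  classical
  refine MultiDigraph.isTotallyCyclic_of_forall_arc fun a0 => ?_
  by_contra hno
  set r := Relation.ReflTransGen (D.dual.contractArcs T).Adj ((D.dual.contractArcs T).head a0)
    with hr
  -- With the value `-1` on the reachable set, which no dual arc leaves, the coboundary left minus
  -- right is nonnegative.
  let φ (F : D.Face) : ℤ := if r (Quot.mk _ F) then -1 else 0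
  have hT (a : A) (ha : a ∈ T) : φ (D.leftFace a) = φ (D.rightFace a) := by
    have : (Quot.mk _ (D.leftFace a) : D.dual.ContractVertex T) = Quot.mk _ (D.rightFace a) :=
      Quot.sound ⟨a, ha, rfl, rfl⟩
    simp only [φ, this]
  have hnonneg (a : A) : 0 ≤ φ (D.leftFace a) - φ (D.rightFace a) := by
    by_cases ha : a ∈ T
    · rw [hT a ha, sub_self]
    · by_cases h1 : r (Quot.mk _ (D.leftFace a))
      · have h2 : r (Quot.mk _ (D.rightFace a)) := h1.tail ⟨⟨a, ha⟩, rfl, rfl⟩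
        simp [φ, h1, h2]
      · simp only [φ, if_neg h1]
        split_ifs <;> norm_num
  have hne : (fun a => φ (D.leftFace a) - φ (D.rightFace a)) ≠ 0 := by
    intro h
    have h0 := congrFun h a0.1
    have h1 : ¬ r (Quot.mk _ (D.leftFace a0.1)) := hno
    have h2 : r (Quot.mk _ (D.rightFace a0.1)) := Relation.ReflTransGen.refl
    simp [φ, h1, h2] at h0
  obtain ⟨C, hC⟩ := (D.isFlow_face_sub φ).exists_conforms hne
  have hdir : C.IsDirected := by
    intro i
    by_contra hi
    have h1 := hC i
    have h2 := hnonneg (C.arc i)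
    simp only [MultiDigraph.WeakCycle.sign, if_neg hi] at h1
    linarith
  obtain ⟨i, hi⟩ := hS.exists_mem C hdir
  have h1 := hC i
  simp only [hT _ (hST hi), sub_self, mul_zero, lt_irrefl] at h1

/-- The face potential of a directed cycle avoiding `S` is constant across arcs of `S`, so it
descends to the contraction. There it never increases along dual arcs and drops by one along those
of the cycle, so the heads of the latter cannot reach their tails. -/
theorem isFeedbackArcSet_of_isTotallyCyclic_dual {S : Set A}
    (h : (D.dual.contractArcs S).IsTotallyCyclic) : D.toMultiDigraph.IsFeedbackArcSet S := by
  rintro ⟨C', hC'⟩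
  set C : D.toMultiDigraph.WeakCycle := C'.ofDeleteArcs with hCdef
  have hC : C.IsDirected := hC'
  have hCS (i) : C.arc i ∉ S := (C'.arc i).2
  obtain ⟨φ, hφ⟩ := D.exists_face_potential C.isFlow_char
  have hS (F F' : D.Face) (hF : ∃ a ∈ S, D.dual.tail a = F ∧ D.dual.head a = F') :
      φ F = φ F' := by
    obtain ⟨a, ha, rfl, rfl⟩ := hF
    refine sub_eq_zero.1 ((hφ a).trans (C.char_eq_zero fun i hi => hCS i ?_))
    rwa [hi]
  let ψ : D.dual.ContractVertex S → ℤ := Quot.lift φ hS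
  have hmono (x y) (hxy : Relation.ReflTransGen (D.dual.contractArcs S).Adj x y) : ψ y ≤ ψ x := by
    induction hxy with
    | refl => exact le_rfl
    | tail _ hyz ih =>
      refine le_trans ?_ ih
      obtain ⟨a, rfl, rfl⟩ := hyz
      have h1 := hC.char_nonneg a.1
      rw [← hφ] at h1
      exact sub_nonneg.1 h1
  let a0 : {a : A // a ∉ S} := C'.arc 0
  have h1 := hmono _ _ (h _ _ (.symm _ _ (.rel _ _ ⟨a0, rfl, rfl⟩)))
  have h2 := hφ a0.1
  have h3 : C.char a0.1 = 1 := (C.char_arc 0).trans (hC.sign_eq_one 0)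
  change φ (D.leftFace a0.1) ≤ φ (D.rightFace a0.1) at h1
  omega

end PlaneDigraph

theorem mainTheorem10 {V A : Type*} [Finite V] [Fintype A] (D : PlaneDigraph V A) (g : A → ℤ) :
    D.toMultiDigraph.IsNLCoflow g ↔ D.dual.IsNLFlow g := by
  constructor
  · rintro ⟨hg, S, hS, hfb⟩
    exact ⟨D.isFlow_dual_of_isCoflow hg, D.isTotallyCyclic_dual_of_isFeedbackArcSet hS hfb⟩
  · rintro ⟨hg, htc⟩
    exact ⟨D.isCoflow_of_isFlow_dual hg, Function.support g, subset_rfl,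
      D.isFeedbackArcSet_of_isTotallyCyclic_dual htc⟩
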